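/- Let $x_0,x_1$ be two letters, let $\mathbb{Q}\langle x_0,x_1\rangle$ be the vector space with basis the words in $x_0,x_1$ (with empty word $\mathbf 1$), graded by weight (the number of letters), and let $\sqcup\!\sqcup$ be the shuffle product on it. Define the linear map $S(\varepsilon_1\cdots\varepsilon_n)=(-1)^n\varepsilon_n\cdots\varepsilon_1$ and, for letters $a,b$ and $f\in\mathbb{Q}\langle x_0,x_1\rangle$, put $I(x_1;f;x_0)=f$, $I(x_0;f;x_1)=S(f)$ and $I(a;f;a)=(f\mid\mathbf 1)\,\mathbf 1$, where $(f\mid\mathbf 1)$ is the constant coefficient. The Goncharov coproduct is the linear map $\Delta_{\rm Gon}:\mathbb{Q}\langle x_0,x_1\rangle\to\mathbb{Q}\langle x_0,x_1\rangle\otimes\mathbb{Q}\langle x_0,x_1\rangle$ with $$\Delta_{\rm Gon}(\varepsilon_1\cdots\varepsilon_n)=\sum_{k\ge 0}\ \sum_{0=i_0<i_1<\cdots<i_k<i_{k+1}=n+1} P_{i_1,\dots,i_k}\otimes\varepsilon_{i_1}\cdots\varepsilon_{i_k},\qquad \varepsilon_0=x_1,\ \varepsilon_{n+1}=x_0,$$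 where $P_{i_1,\dots,i_k}$ is the shuffle product over $p=0,\dots,k$ of the elements $I(\varepsilon_{i_p};\varepsilon_{i_p+1}\cdots\varepsilon_{i_{p+1}-1};\varepsilon_{i_{p+1}})$. Let $\mathfrak{L}$ be the free Lie algebra over $\mathbb{Q}$ on $x_0,x_1$, with enveloping algebra $\mathcal U(\mathfrak L)$, the free associative algebra on $x_0,x_1$, and with coproduct $\Delta(x_i)=x_i\otimes 1+1\otimes x_i$, written $\Delta(A)=A_{(1)}\otimes A_{(2)}$. For $f,g\in\mathfrak{L}$ put $f\triangleright g=d_f(g)$, where $d_f$ is the derivation of $\mathfrak{L}$ with $d_f(x_0)=0$ and $d_f(x_1)=[x_1,f]$. There is a unique bilinear extension of $\triangleright$ to $\mathcal U(\mathfrak L)$ with $x\triangleright 1=0$, $1\triangleright A=A$, $xA\triangleright y=x\triangleright(A\triangleright y)-(x\triangleright A)\triangleright y$ and $A\triangleright BC=(A_{(1)}\triangleright B)(A_{(2)}\triangleright C)$ for all $x,y\in\mathfrak L$ and $A,B,C\in\mathcal U(\mathfrak L)$. The Grossman–Larson product is $A\circledast B=A_{(1)}(A_{(2)}\triangleright B)$.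 It respects the weight and so extends to the completion $\widehat{\mathcal U}=\mathbb{Q}\langle\langle x_0,x_1\rangle\rangle$. Let $(\phi\mid w)$ denote the coefficient of the word $w$ in $\phi\in\widehat{\mathcal U}$, extended linearly in $w$, and put $(\phi\otimes\psi\mid u\otimes v)=(\phi\mid u)(\psi\mid v)$. A series $G\in\widehat{\mathcal U}$ is grouplike if $G\ne 0$ and $(G\mid u\sqcup\!\sqcup v)=(G\mid u)(G\mid v)$ for all words $u,v$, that is, if $\sum_{u,v}(G\mid u\sqcup\!\sqcup v)\,u\otimes v=G\otimes G$. Then: 1. For every grouplike series $G\in\widehat{\mathcal U}$, every series $H\in\widehat{\mathcal U}$ (in particular every grouplike $H$) and every $w\in\mathbb{Q}\langle x_0,x_1\rangle$, $$(G\circledast H\mid w)=(G\otimes H\mid\Delta_{\rm Gon}(w)).$$ 2. $(\mathbb{Q}\langle x_0,x_1\rangle,\sqcup\!\sqcup,\Delta_{\rm Gon})$ is a weight-graded Hopf algebra: $\Delta_{\rm Gon}$ is a morphism of algebras for $\sqcup\!\sqcup$, it is coassociative, it has a counit which is a morphism of algebras, and there is an antipode; moreover the weight spaces, which are finite-dimensional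 and have $\mathbb{Q}\langle x_0,x_1\rangle$ as their direct sum, are respected by the product, the coproduct and the antipode. -/

import Mathlib

open scoped TensorProduct

namespace Goncharov

/-- The alphabet `{x₀, x₁}`: `0` stands for `x₀` and `1` for `x₁`. -/
abbrev Letter : Type := Fin 2

/-- Words in the letters `x₀, x₁`; the empty word is `[]`. -/
abbrev Word : Type := List Letter

/-- The vector space `ℚ⟨x₀,x₁⟩` with basis the words. As a ring it carries the shuffle product,
see the instance `CommRing QX` below. -/
def QX : Type := Word →₀ ℚ

namespace QX

noncomputable instance : AddCommGroup QX := inferInstanceAs (AddCommGroup (Word →₀ ℚ))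

noncomputable instance : Module ℚ QX := inferInstanceAs (Module ℚ (Word →₀ ℚ))

/-- The basis of words. -/
noncomputable def basis : Module.Basis Word ℚ QX := ⟨LinearEquiv.refl ℚ (Word →₀ ℚ)⟩

/-- A word as an element of `ℚ⟨x₀,x₁⟩`. -/
noncomputable def word (w : Word) : QX := basis w

/-- Left concatenation with the letter `a`, that is `w ↦ a w`. -/
noncomputable def cons (a : Letter) : QX →ₗ[ℚ] QX := basis.constr ℚ fun w => word (a :: w)

@[simp] theorem cons_word (a : Letter) (w : Word) : cons a (word w) = word (a :: w) :=
  basis.constr_basis ℚ _ w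

/-- The shuffle product of two words:
`1 ш v = v`, `u ш 1 = u`, `au ш bv = a (u ш bv) + b (au ш v)`. -/
noncomputable def shuffleWord : Word → Word → QX
  | [], v => word v
  | a :: u, [] => word (a :: u)
  | a :: u, b :: v => cons a (shuffleWord u (b :: v)) + cons b (shuffleWord (a :: u) v)
termination_by u v => u.length + v.length

/-- The shuffle product, extended bilinearly. -/
noncomputable def shuffle : QX →ₗ[ℚ] QX →ₗ[ℚ] QX :=
  basis.constr ℚ fun u => basis.constr ℚ fun v => shuffleWord u v

theorem shuffle_word (u v : Word) : shuffle (word u) (word v) = shuffleWord u v := by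
  simp [shuffle, word, Module.Basis.constr_basis]

theorem shuffle_nil_left (x : QX) : shuffle (word []) x = x := by
  have : shuffle (word []) = LinearMap.id := basis.ext fun w => by
    change shuffle (word []) (word w) = word w
    rw [shuffle_word, shuffleWord]
  simp [this]

theorem shuffle_nil_right (x : QX) : shuffle x (word []) = x := by
  have : shuffle.flip (word []) = LinearMap.id := basis.ext fun w => by
    change shuffle (word w) (word []) = word w
    rw [shuffle_word]
    cases w <;> rw [shuffleWord]
  simpa using LinearMap.congr_fun this x

theorem shuffle_cons_cons (a b : Letter) (x y : QX) :
    shuffle (cons a x) (cons b y) =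
      cons a (shuffle x (cons b y)) + cons b (shuffle (cons a x) y) := by
  have : shuffle.compl₁₂ (cons a) (cons b) =
      (shuffle.compl₁₂ LinearMap.id (cons b)).compr₂ (cons a) +
        (shuffle.compl₁₂ (cons a) LinearMap.id).compr₂ (cons b) := by
    refine basis.ext fun u => basis.ext fun v => ?_
    change shuffle (cons a (word u)) (cons b (word v)) =
      cons a (shuffle (word u) (cons b (word v))) + cons b (shuffle (cons a (word u)) (word v))
    simp only [cons_word, shuffle_word]
    rw [shuffleWord]
  exact LinearMap.congr_fun₂ this x y

theorem shuffleWord_comm (u v : Word) : shuffleWord u v = shuffleWord v u := by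
  induction u generalizing v with
  | nil => cases v <;> simp [shuffleWord]
  | cons a u ih =>
    induction v with
    | nil => simp [shuffleWord]
    | cons b v ihv => rw [shuffleWord, shuffleWord, ih, ihv, add_comm]

theorem shuffle_comm (x y : QX) : shuffle x y = shuffle y x := by
  have : shuffle = shuffle.flip := by
    refine basis.ext fun u => basis.ext fun v => ?_
    change shuffle (word u) (word v) = shuffle (word v) (word u)
    rw [shuffle_word, shuffle_word, shuffleWord_comm]
  exact LinearMap.congr_fun₂ this x y

theorem shuffle_assoc_word (n : ℕ) : ∀ u v w : Word, u.length + v.length + w.length = n →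
    shuffle (shuffle (word u) (word v)) (word w) =
      shuffle (word u) (shuffle (word v) (word w)) := by
  induction n with
  | zero =>
    intro u v w h
    have hu : u = [] := List.length_eq_zero_iff.mp (by omega)
    subst hu
    simp [shuffle_nil_left]
  | succ n ih =>
    intro u v w h
    rcases u with _ | ⟨a, u⟩
    · simp [shuffle_nil_left]
    rcases v with _ | ⟨b, v⟩
    · simp [shuffle_nil_left, shuffle_nil_right]
    rcases w with _ | ⟨c, w⟩
    · simp [shuffle_nil_right]
    have h1 := ih u (b :: v) (c :: w) (by simp at h ⊢; omega)
    have h2 := ih (a :: u) v (c :: w) (by simp at h ⊢; omega)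
    have h3 := ih (a :: u) (b :: v) w (by simp at h ⊢; omega)
    simp only [← cons_word] at h1 h2 h3 ⊢
    simp only [shuffle_cons_cons, map_add, LinearMap.add_apply] at h1 h2 h3 ⊢
    simp only [h1, h2, ← h3, map_add]
    abel

theorem induction_word {P : QX → Prop} (h : ∀ w, P (word w)) (hadd : ∀ x y, P x → P y → P (x + y))
    (hsmul : ∀ (r : ℚ) x, P x → P (r • x)) (x : QX) : P x := by
  refine Submodule.span_induction (p := fun x _ => P x) ?_ ?_ (fun x y _ _ => hadd x y)
    (fun r x _ => hsmul r x) (basis.mem_span x)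
  · rintro _ ⟨w, rfl⟩
    exact h w
  · simpa using hsmul 0 _ (h [])

theorem shuffle_assoc (x y z : QX) : shuffle (shuffle x y) z = shuffle x (shuffle y z) := by
  induction x using induction_word with
  | hadd x x' hx hx' => simp only [map_add, LinearMap.add_apply, hx, hx']
  | hsmul r x hx => simp only [map_smul, LinearMap.smul_apply, hx]
  | h u =>
  induction y using induction_word with
  | hadd x x' hx hx' => simp only [map_add, LinearMap.add_apply, hx, hx']
  | hsmul r x hx => simp only [map_smul, LinearMap.smul_apply, hx]
  | h v =>
  induction z using induction_word with
  | hadd x x' hx hx' => simp only [map_add, hx, hx']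
  | hsmul r x hx => simp only [map_smul, hx]
  | h w => exact shuffle_assoc_word _ u v w rfl

noncomputable instance : CommRing QX where
  __ := (inferInstance : AddCommGroup QX)
  mul x y := shuffle x y
  one := word []
  mul_assoc := shuffle_assoc
  mul_comm := shuffle_comm
  one_mul := shuffle_nil_left
  mul_one := shuffle_nil_right
  left_distrib x y z := map_add (shuffle x) y z
  right_distrib x y z := LinearMap.map_add₂ shuffle x y z
  zero_mul x := LinearMap.map_zero₂ shuffle x
  mul_zero x := map_zero (shuffle x)

noncomputable instance : Algebra ℚ QX :=
  Algebra.ofModule (fun r x y => LinearMap.map_smul₂ shuffle r x y)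
    (fun r x y => map_smul (shuffle x) r y)

theorem mul_def (x y : QX) : x * y = shuffle x y := rfl

theorem one_def : (1 : QX) = word [] := rfl

/-- The coefficient of the empty word, `f ↦ (f | 1)`. -/
noncomputable def constCoeff : QX →ₗ[ℚ] ℚ := basis.coord []

/-- The map `ε₁⋯εₙ ↦ (-1)ⁿ εₙ⋯ε₁`. -/
noncomputable def antipode : QX →ₗ[ℚ] QX :=
  basis.constr ℚ fun w => (-1 : ℚ) ^ w.length • word w.reverse

/-- The weight `n` part of `ℚ⟨x₀,x₁⟩`, spanned by the words with `n` letters. -/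
noncomputable def weightPart (n : ℕ) : Submodule ℚ QX :=
  Submodule.span ℚ (word '' {w | w.length = n})

/-- The symbol `I(a; f; b)`: it is `f` for `(a, b) = (x₁, x₀)`, `S(f)` for `(a, b) = (x₀, x₁)` and
`(f | 1) · 1` for `a = b`. -/
noncomputable def iter (a : Letter) (f : QX) (b : Letter) : QX :=
  if a = b then constCoeff f • (1 : QX)
  else if a = 1 then f
  else antipode f

/-- For `w = ε₁⋯εₙ` this is `j ↦ ε_j` where `ε₀ = x₁` and `ε_{n+1} = x₀`. -/
def extLetter (w : Word) (j : ℕ) : Letter := (1 :: w).getD j 0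

/-- The quotient word `ε_{p+1}⋯ε_{q-1}` of `w = ε₁⋯εₙ`. -/
def quotWord (w : Word) (p q : ℕ) : Word := (List.range' (p + 1) (q - p - 1)).map (extLetter w)

/-- For `w = ε₁⋯εₙ` and `I = [i₁, …, i_k]`, the shuffle product over `p = 0, …, k` of the elements
`I(ε_{i_p}; ε_{i_p+1}⋯ε_{i_{p+1}-1}; ε_{i_{p+1}})`, where `i₀ = 0` and `i_{k+1} = n+1`. -/
noncomputable def quotProd (w : Word) (I : List ℕ) : QX :=
  (List.zipWith (fun p q => iter (extLetter w p) (word (quotWord w p q)) (extLetter w q))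
    (0 :: I) (I ++ [w.length + 1])).prod

/-- The Goncharov coproduct. On the word `w = ε₁⋯εₙ` it is the sum over all index sequences
`1 ≤ i₁ < ⋯ < i_k ≤ n` (the sublists of `[1, …, n]`) of
`(ш_p I(ε_{i_p}; ε_{i_p+1}⋯ε_{i_{p+1}-1}; ε_{i_{p+1}})) ⊗ ε_{i₁}⋯ε_{i_k}`. -/
noncomputable def gon : QX →ₗ[ℚ] QX ⊗[ℚ] QX :=
  basis.constr ℚ fun w =>
    ((List.range' 1 w.length).sublists'.map fun I =>
      quotProd w I ⊗ₜ[ℚ] word (I.map (extLetter w))).sum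

end QX

/-! ### Graded Hopf algebras -/

section Hopf

variable {R A : Type*} [CommRing R] [Ring A] [Algebra R A]

/-- The algebra `A` with the coproduct `Δ`, the counit `ε` and the antipode `S` is a Hopf
algebra (`Δ` and `ε` are morphisms of algebras, `S` is linear). -/
structure IsHopfAlgebra (Δ : A →ₐ[R] A ⊗[R] A) (ε : A →ₐ[R] R) (S : A →ₗ[R] A) : Prop where
  coassoc : (TensorProduct.assoc R A A A).toLinearMap ∘ₗ Δ.toLinearMap.rTensor A ∘ₗ Δ.toLinearMap =
    Δ.toLinearMap.lTensor A ∘ₗ Δ.toLinearMap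
  counit_left : ε.toLinearMap.rTensor A ∘ₗ Δ.toLinearMap = TensorProduct.mk R R A 1
  counit_right : ε.toLinearMap.lTensor A ∘ₗ Δ.toLinearMap = (TensorProduct.mk R A R).flip 1
  antipode_left : LinearMap.mul' R A ∘ₗ S.rTensor A ∘ₗ Δ.toLinearMap =
    Algebra.linearMap R A ∘ₗ ε.toLinearMap
  antipode_right : LinearMap.mul' R A ∘ₗ S.lTensor A ∘ₗ Δ.toLinearMap =
    Algebra.linearMap R A ∘ₗ ε.toLinearMap

/-- The Hopf algebra of Mathlib given by `IsHopfAlgebra`. -/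
noncomputable abbrev IsHopfAlgebra.toHopfAlgebra {Δ : A →ₐ[R] A ⊗[R] A} {ε : A →ₐ[R] R}
    {S : A →ₗ[R] A} (h : IsHopfAlgebra Δ ε S) : HopfAlgebra R A :=
  letI : Coalgebra R A :=
    { comul := Δ.toLinearMap
      counit := ε.toLinearMap
      coassoc := h.coassoc
      rTensor_counit_comp_comul := h.counit_left
      lTensor_counit_comp_comul := h.counit_right }
  letI : Bialgebra R A := .mk' _ _ (map_one ε) (map_mul ε _ _) (map_one Δ) (map_mul Δ _ _)
  { antipode := S
    mul_antipode_rTensor_comul := h.antipode_left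
    mul_antipode_lTensor_comul := h.antipode_right }

/-- The submodules `𝒜 n`, free of finite rank, form a grading of the Hopf algebra `A` with
coproduct `Δ` and antipode `S`. -/
structure IsHopfGrading (𝒜 : ℕ → Submodule R A) (Δ : A →ₗ[R] A ⊗[R] A) (S : A →ₗ[R] A) :
    Prop where
  isInternal : DirectSum.IsInternal 𝒜
  free : ∀ n, Module.Free R (𝒜 n)
  finite : ∀ n, Module.Finite R (𝒜 n)
  one_mem : (1 : A) ∈ 𝒜 0
  mul_mem : ∀ i j, ∀ a ∈ 𝒜 i, ∀ b ∈ 𝒜 j, a * b ∈ 𝒜 (i + j)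
  comul_mem : ∀ n, ∀ a ∈ 𝒜 n, Δ a ∈ ⨆ (i : ℕ) (j : ℕ) (_ : i + j = n),
    LinearMap.range (TensorProduct.map (𝒜 i).subtype (𝒜 j).subtype)
  antipode_mem : ∀ n, ∀ a ∈ 𝒜 n, S a ∈ 𝒜 n

end Hopf

/-! ### The free Lie algebra and the Ihara post-Lie product -/

/-- The free Lie algebra on `x₀, x₁` over `ℚ`. -/
abbrev FL : Type := FreeLieAlgebra ℚ Letter

namespace FL

theorem induction {P : FL → Prop} (hof : ∀ i, P (FreeLieAlgebra.of ℚ i))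
    (hadd : ∀ x y, P x → P y → P (x + y)) (hsmul : ∀ (r : ℚ) x, P x → P (r • x))
    (hlie : ∀ x y, P x → P y → P ⁅x, y⁆) (x : FL) : P x := by
  let K : LieSubalgebra ℚ FL :=
    { carrier := {x | P x}
      add_mem' := fun hx hy => hadd _ _ hx hy
      zero_mem' := by
        have := hsmul 0 _ (hof 0)
        rwa [zero_smul] at this
      smul_mem' := fun r _ hx => hsmul r _ hx
      lie_mem' := fun hx hy => hlie _ _ hx hy }
  let F : FL →ₗ⁅ℚ⁆ K := FreeLieAlgebra.lift ℚ fun i => ⟨FreeLieAlgebra.of ℚ i, hof i⟩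
  have h : K.incl.comp F = LieHom.id := by
    ext i
    simp [F]
  have h2 := LieHom.congr_fun h x
  have h3 : ((F x : K) : FL) = x := h2
  rw [← h3]
  exact (F x).2

/-- The square-zero extension of the free Lie algebra by its adjoint representation. -/
def SqZero : Type := FL × FL

namespace SqZero

noncomputable instance : AddCommGroup SqZero := inferInstanceAs (AddCommGroup (FL × FL))

noncomputable instance : Module ℚ SqZero := inferInstanceAs (Module ℚ (FL × FL))

noncomputable instance : LieRing SqZero where
  bracket a b := (⁅a.1, b.1⁆, ⁅a.1, b.2⁆ + ⁅a.2, b.1⁆)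
  add_lie a b c := by
    refine Prod.ext (add_lie a.1 b.1 c.1) ?_
    change ⁅a.1 + b.1, c.2⁆ + ⁅a.2 + b.2, c.1⁆ =
      (⁅a.1, c.2⁆ + ⁅a.2, c.1⁆) + (⁅b.1, c.2⁆ + ⁅b.2, c.1⁆)
    simp only [add_lie]
    abel
  lie_add a b c := by
    refine Prod.ext (lie_add a.1 b.1 c.1) ?_
    change ⁅a.1, b.2 + c.2⁆ + ⁅a.2, b.1 + c.1⁆ =
      (⁅a.1, b.2⁆ + ⁅a.2, b.1⁆) + (⁅a.1, c.2⁆ + ⁅a.2, c.1⁆)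
    simp only [lie_add]
    abel
  lie_self a := by
    refine Prod.ext (lie_self a.1) ?_
    change ⁅a.1, a.2⁆ + ⁅a.2, a.1⁆ = 0
    rw [← lie_skew, neg_add_cancel]
  leibniz_lie a b c := by
    refine Prod.ext (leibniz_lie a.1 b.1 c.1) ?_
    change ⁅a.1, ⁅b.1, c.2⁆ + ⁅b.2, c.1⁆⁆ + ⁅a.2, ⁅b.1, c.1⁆⁆ =
      (⁅⁅a.1, b.1⁆, c.2⁆ + ⁅⁅a.1, b.2⁆ + ⁅a.2, b.1⁆, c.1⁆) +
        (⁅b.1, ⁅a.1, c.2⁆ + ⁅a.2, c.1⁆⁆ + ⁅b.2, ⁅a.1, c.1⁆⁆)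
    simp only [lie_add, add_lie]
    rw [leibniz_lie a.1 b.1 c.2, leibniz_lie a.1 b.2 c.1, leibniz_lie a.2 b.1 c.1]
    abel

noncomputable instance : LieAlgebra ℚ SqZero where
  lie_smul r a b := by
    refine Prod.ext (lie_smul r a.1 b.1) ?_
    change ⁅a.1, r • b.2⁆ + ⁅a.2, r • b.1⁆ = r • (⁅a.1, b.2⁆ + ⁅a.2, b.1⁆)
    simp only [lie_smul, smul_add]

/-- The morphism `g ↦ (g, d_f(g))` of Lie algebras. -/
noncomputable def hom (f : FL) : FL →ₗ⁅ℚ⁆ SqZero :=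
  FreeLieAlgebra.lift ℚ fun i =>
    (FreeLieAlgebra.of ℚ i, if i = 1 then ⁅FreeLieAlgebra.of ℚ (1 : Letter), f⁆ else 0)

theorem hom_of (f : FL) (i : Letter) : hom f (FreeLieAlgebra.of ℚ i) =
    (FreeLieAlgebra.of ℚ i, if i = 1 then ⁅FreeLieAlgebra.of ℚ (1 : Letter), f⁆ else 0) :=
  FreeLieAlgebra.lift_of_apply _ _

theorem hom_fst (f x : FL) : (hom f x).1 = x := by
  induction x using FL.induction with
  | hof i => rw [hom_of]
  | hadd x y hx hy =>
    rw [map_add]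
    change (hom f x).1 + (hom f y).1 = _
    rw [hx, hy]
  | hsmul r x hx =>
    rw [map_smul]
    change r • (hom f x).1 = _
    rw [hx]
  | hlie x y hx hy =>
    rw [LieHom.map_lie]
    change ⁅(hom f x).1, (hom f y).1⁆ = _
    rw [hx, hy]

end SqZero

/-- The special derivation `d_f` of the free Lie algebra, with `d_f(x₀) = 0` and
`d_f(x₁) = [x₁, f]` (see `specialDer_of`). -/
noncomputable def specialDer (f : FL) : LieDerivation ℚ FL FL where
  toFun x := (SqZero.hom f x).2
  map_add' x y := by rw [map_add]; rfl
  map_smul' r x := by rw [map_smul]; rfl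
  leibniz' x y := by
    change (SqZero.hom f ⁅x, y⁆).2 = ⁅x, (SqZero.hom f y).2⁆ - ⁅y, (SqZero.hom f x).2⁆
    rw [LieHom.map_lie]
    change ⁅(SqZero.hom f x).1, (SqZero.hom f y).2⁆ + ⁅(SqZero.hom f x).2, (SqZero.hom f y).1⁆ = _
    rw [SqZero.hom_fst, SqZero.hom_fst, ← lie_skew y, sub_neg_eq_add]

theorem specialDer_of (f : FL) (i : Letter) : specialDer f (FreeLieAlgebra.of ℚ i) =
    if i = 1 then ⁅FreeLieAlgebra.of ℚ (1 : Letter), f⁆ else 0 := by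
  change (SqZero.hom f (FreeLieAlgebra.of ℚ i)).2 = _
  rw [SqZero.hom_of]

/-- The post-Lie product `f ▷ g = d_f(g)` on the free Lie algebra. -/
noncomputable def tri (f g : FL) : FL := specialDer f g

end FL

/-! ### The enveloping algebra -/

/-- The enveloping algebra of the free Lie algebra: the free associative algebra on `x₀, x₁` with
the concatenation product (see `FreeLieAlgebra.universalEnvelopingEquivFreeAlgebra`). -/
abbrev UL : Type := FreeAlgebra ℚ Letter

namespace UL

section

attribute [local instance 100] LieRing.ofAssociativeRing

/-- The canonical map from the free Lie algebra to its enveloping algebra, `xᵢ ↦ xᵢ`. -/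
noncomputable def ofLie : FL →ₗ[ℚ] UL :=
  (FreeLieAlgebra.lift ℚ (FreeAlgebra.ι ℚ : Letter → UL) : FL →ₗ⁅ℚ⁆ UL).toLinearMap

theorem ofLie_of (i : Letter) : ofLie (FreeLieAlgebra.of ℚ i) = FreeAlgebra.ι ℚ i :=
  FreeLieAlgebra.lift_of_apply _ _

theorem ofLie_lie (x y : FL) : ofLie ⁅x, y⁆ = ofLie x * ofLie y - ofLie y * ofLie x :=
  LieHom.map_lie (FreeLieAlgebra.lift ℚ (FreeAlgebra.ι ℚ : Letter → UL)) x y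

end

/-- The coproduct of the enveloping algebra, the morphism of algebras with
`Δ(xᵢ) = xᵢ ⊗ 1 + 1 ⊗ xᵢ`. -/
noncomputable def delta : UL →ₐ[ℚ] UL ⊗[ℚ] UL :=
  FreeAlgebra.lift ℚ fun i => FreeAlgebra.ι ℚ i ⊗ₜ[ℚ] 1 + 1 ⊗ₜ[ℚ] FreeAlgebra.ι ℚ i

/-- `tr` extends the post-Lie product of the free Lie algebra to its enveloping algebra by the
rules `x ▷ 1 = 0`, `1 ▷ A = A`, `xA ▷ y = x ▷ (A ▷ y) - (x ▷ A) ▷ y` and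
`A ▷ BC = (A₍₁₎ ▷ B)(A₍₂₎ ▷ C)`, for `A, B, C` in the enveloping algebra and `x, y` in the Lie
algebra. -/
structure IsExtension (tr : UL →ₗ[ℚ] UL →ₗ[ℚ] UL) : Prop where
  tr_lie : ∀ x y : FL, tr (ofLie x) (ofLie y) = ofLie (FL.tri x y)
  lie_one : ∀ x : FL, tr (ofLie x) 1 = 0
  one_tr : ∀ A : UL, tr 1 A = A
  lie_mul_tr : ∀ (x y : FL) (A : UL), tr (ofLie x * A) (ofLie y) =
    tr (ofLie x) (tr A (ofLie y)) - tr (tr (ofLie x) A) (ofLie y)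
  tr_mul : ∀ A B C : UL, tr A (B * C) =
    LinearMap.mul' ℚ UL (TensorProduct.map (tr.flip B) (tr.flip C) (delta A))

/-! #### Existence and uniqueness of the extension -/

theorem delta_ι (i : Letter) : delta (FreeAlgebra.ι ℚ i) =
    FreeAlgebra.ι ℚ i ⊗ₜ[ℚ] 1 + 1 ⊗ₜ[ℚ] FreeAlgebra.ι ℚ i := by
  simp [delta]

/-- The augmentation of the enveloping algebra. -/
noncomputable def aug : UL →ₐ[ℚ] ℚ := FreeAlgebra.lift ℚ fun _ => 0

noncomputable instance : Coalgebra ℚ UL where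
  comul := delta.toLinearMap
  counit := aug.toLinearMap
  coassoc := by
    have : ((Algebra.TensorProduct.assoc ℚ ℚ ℚ UL UL UL).toAlgHom.comp
        ((Algebra.TensorProduct.map delta (.id ℚ UL)).comp delta)) =
        (Algebra.TensorProduct.map (.id ℚ UL) delta).comp delta := by
      ext i
      simp [delta, TensorProduct.add_tmul, TensorProduct.tmul_add,
        Algebra.TensorProduct.one_def, add_assoc]
    exact congr(($this).toLinearMap)
  rTensor_counit_comp_comul := by
    have : (Algebra.TensorProduct.map aug (.id ℚ UL)).comp delta =
        (Algebra.TensorProduct.lid ℚ UL).symm := by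
      ext i
      simp [delta, aug]
    exact congr(($this).toLinearMap)
  lTensor_counit_comp_comul := by
    have : (Algebra.TensorProduct.map (.id ℚ UL) aug).comp delta =
        (Algebra.TensorProduct.rid ℚ ℚ UL).symm := by
      ext i
      simp [delta, aug]
    exact congr(($this).toLinearMap)

theorem delta_ofLie (x : FL) : delta (ofLie x) = ofLie x ⊗ₜ[ℚ] 1 + 1 ⊗ₜ[ℚ] ofLie x := by
  induction x using FL.induction with
  | hof i => rw [ofLie_of, delta_ι]
  | hadd x y hx hy =>
    simp only [map_add, hx, hy, TensorProduct.add_tmul, TensorProduct.tmul_add]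
    abel
  | hsmul r x hx =>
    simp only [map_smul, hx, TensorProduct.smul_tmul', TensorProduct.tmul_smul, smul_add]
  | hlie x y hx hy =>
    simp only [ofLie_lie, map_sub, map_mul, hx, hy, mul_add, add_mul,
      Algebra.TensorProduct.tmul_mul_tmul, one_mul, mul_one, TensorProduct.sub_tmul,
      TensorProduct.tmul_sub]
    abel

theorem aug_ofLie (x : FL) : aug (ofLie x) = 0 := by
  induction x using FL.induction with
  | hof i => simp [ofLie_of, aug]
  | hadd x y hx hy => simp [hx, hy]
  | hsmul r x hx => simp [hx]
  | hlie x y hx hy => simp [ofLie_lie, hx, hy]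

/-- The right adjoint action: `adR (a₁⋯aₙ) y = [⋯[[y, a₁], a₂], …, aₙ]`. -/
noncomputable def adR : UL →ₐ[ℚ] (Module.End ℚ UL)ᵐᵒᵖ :=
  FreeAlgebra.lift ℚ fun i => MulOpposite.op
    (LinearMap.mulRight ℚ (FreeAlgebra.ι ℚ i) - LinearMap.mulLeft ℚ (FreeAlgebra.ι ℚ i))

theorem adR_mul (A B y : UL) : (adR (A * B)).unop y = (adR B).unop ((adR A).unop y) := by
  rw [map_mul]
  rfl

theorem adR_ofLie (x : FL) (y : UL) : (adR (ofLie x)).unop y = y * ofLie x - ofLie x * y := by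
  induction x using FL.induction generalizing y with
  | hof i => simp [ofLie_of, adR]
  | hadd x z hx hz =>
    simp only [map_add, MulOpposite.unop_add, LinearMap.add_apply, hx, hz, mul_add, add_mul]
    abel
  | hsmul r x hx =>
    simp only [map_smul, MulOpposite.unop_smul, LinearMap.smul_apply, hx, mul_smul_comm,
      smul_mul_assoc, smul_sub]
  | hlie x z hx hz =>
    simp only [ofLie_lie, map_sub, MulOpposite.unop_sub, LinearMap.sub_apply, adR_mul, hx, hz]
    simp only [mul_sub, sub_mul, mul_assoc]
    abel

/-- The value on `(B, A)` of this morphism to the convolution algebra is `A ▷ B`. -/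
noncomputable def trConv : UL →ₐ[ℚ] WithConv (UL →ₗ[ℚ] UL) :=
  FreeAlgebra.lift ℚ fun i => WithConv.toConv <|
    if i = 1 then
      { toFun := fun A => (adR A).unop (FreeAlgebra.ι ℚ 1)
        map_add' := fun A B => by simp
        map_smul' := fun r A => by simp }
    else (LinearMap.toSpanSingleton ℚ UL (FreeAlgebra.ι ℚ i)) ∘ₗ aug.toLinearMap

/-- The extended product `A ▷ B`, as a bilinear map. -/
noncomputable def trFun : UL →ₗ[ℚ] UL →ₗ[ℚ] UL :=
  LinearMap.mk₂ ℚ (fun A B => (trConv B).ofConv A) (by simp) (by simp) (by simp) (by simp)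

theorem trFun_mul (A B C : UL) : trFun A (B * C) =
    LinearMap.mul' ℚ UL (TensorProduct.map (trFun.flip B) (trFun.flip C) (delta A)) := by
  change (trConv (B * C)).ofConv A = _
  rw [map_mul]
  rfl

theorem trFun_one (A : UL) : trFun A 1 = algebraMap ℚ UL (aug A) := by
  change (trConv 1).ofConv A = _
  rw [map_one]
  rfl

theorem trFun_algebraMap (A : UL) (r : ℚ) :
    trFun A (algebraMap ℚ UL r) = r • algebraMap ℚ UL (aug A) := by
  rw [Algebra.algebraMap_eq_smul_one, map_smul, trFun_one]

theorem trFun_ι_zero (A : UL) :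
    trFun A (FreeAlgebra.ι ℚ 0) = aug A • (FreeAlgebra.ι ℚ 0 : UL) := by
  change (trConv (FreeAlgebra.ι ℚ 0)).ofConv A = _
  simp [trConv]

theorem trFun_ι_one (A : UL) :
    trFun A (FreeAlgebra.ι ℚ 1) = (adR A).unop (FreeAlgebra.ι ℚ 1) := by
  change (trConv (FreeAlgebra.ι ℚ 1)).ofConv A = _
  simp [trConv]

theorem one_trFun (A : UL) : trFun 1 A = A := by
  induction A using FreeAlgebra.induction with
  | grade0 r => rw [trFun_algebraMap, map_one, map_one, Algebra.algebraMap_eq_smul_one]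
  | grade1 i =>
    fin_cases i
    · simp [trFun_ι_zero]
    · simp [trFun_ι_one]
  | mul A B hA hB => simp [trFun_mul, Algebra.TensorProduct.one_def, hA, hB]
  | add A B hA hB => rw [map_add, hA, hB]

/-- A bilinear map satisfying part of the rules of `IsExtension` acts by derivations. -/
theorem lie_tr_mul {tr : UL →ₗ[ℚ] UL →ₗ[ℚ] UL} (h1 : ∀ A : UL, tr 1 A = A)
    (hmul : ∀ A B C : UL, tr A (B * C) =
      LinearMap.mul' ℚ UL (TensorProduct.map (tr.flip B) (tr.flip C) (delta A)))
    (x : FL) (A B : UL) :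
    tr (ofLie x) (A * B) = tr (ofLie x) A * B + A * tr (ofLie x) B := by
  simp [hmul, delta_ofLie, h1]

theorem lie_trFun_mul (x : FL) (A B : UL) :
    trFun (ofLie x) (A * B) = trFun (ofLie x) A * B + A * trFun (ofLie x) B :=
  lie_tr_mul one_trFun trFun_mul x A B

theorem lie_trFun_one (x : FL) : trFun (ofLie x) 1 = 0 := by
  rw [trFun_one, aug_ofLie, map_zero]

theorem tri_of (x : FL) (i : Letter) : FL.tri x (FreeLieAlgebra.of ℚ i) =
    if i = 1 then ⁅FreeLieAlgebra.of ℚ (1 : Letter), x⁆ else 0 :=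
  FL.specialDer_of x i

theorem trFun_lie (x y : FL) : trFun (ofLie x) (ofLie y) = ofLie (FL.tri x y) := by
  induction y using FL.induction with
  | hof i =>
    rw [tri_of, ofLie_of]
    fin_cases i
    · simp [trFun_ι_zero, aug_ofLie]
    · simp [trFun_ι_one, adR_ofLie, ofLie_lie, ofLie_of]
  | hadd y z hy hz =>
    simp only [FL.tri, map_add] at *
    rw [hy, hz]
  | hsmul r y hy =>
    simp only [FL.tri, map_smul] at *
    rw [hy]
  | hlie y z hy hz =>
    simp only [FL.tri] at *
    rw [ofLie_lie, LieDerivation.apply_lie_eq_add]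
    simp only [map_sub, map_add, lie_trFun_mul, hy, hz, ofLie_lie]
    abel

/-- For `x` in the Lie algebra, `x ▷ -` is a coderivation. -/
theorem delta_lie_trFun (x : FL) (A : UL) : delta (trFun (ofLie x) A) =
    ((trFun (ofLie x)).rTensor UL + (trFun (ofLie x)).lTensor UL) (delta A) := by
  have hder : ∀ s t : UL ⊗[ℚ] UL,
      ((trFun (ofLie x)).rTensor UL + (trFun (ofLie x)).lTensor UL) (s * t) =
      ((trFun (ofLie x)).rTensor UL + (trFun (ofLie x)).lTensor UL) s * t +
      s * ((trFun (ofLie x)).rTensor UL + (trFun (ofLie x)).lTensor UL) t := by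
    intro s t
    induction s with
    | zero => simp
    | add s s' hs hs' => rw [add_mul, map_add, hs, hs', map_add]; noncomm_ring
    | tmul a b =>
      induction t with
      | zero => simp
      | add t t' ht ht' => rw [mul_add, map_add, ht, ht', map_add]; noncomm_ring
      | tmul c d =>
        simp only [Algebra.TensorProduct.tmul_mul_tmul, LinearMap.add_apply,
          LinearMap.rTensor_tmul, LinearMap.lTensor_tmul, lie_trFun_mul, TensorProduct.add_tmul,
          TensorProduct.tmul_add, add_mul, mul_add]
        abel
  induction A using FreeAlgebra.induction with
  | grade0 r =>
    rw [trFun_algebraMap, aug_ofLie, AlgHom.commutes,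
      Algebra.algebraMap_eq_smul_one (A := UL ⊗[ℚ] UL), Algebra.TensorProduct.one_def]
    simp [lie_trFun_one]
  | grade1 i =>
    rw [← ofLie_of, trFun_lie, delta_ofLie, delta_ofLie]
    simp [lie_trFun_one, trFun_lie]
  | mul A B hA hB => rw [lie_trFun_mul, map_add, map_mul, map_mul, map_mul, hA, hB, hder]
  | add A B hA hB => rw [map_add, map_add, map_add, map_add, hA, hB]

theorem adR_trFun (x : FL) (A y : UL) : trFun (ofLie x) ((adR A).unop y) =
    (adR A).unop (trFun (ofLie x) y) + (adR (trFun (ofLie x) A)).unop y := by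
  induction A using FreeAlgebra.induction generalizing y with
  | grade0 r =>
    rw [trFun_algebraMap, aug_ofLie, AlgHom.commutes, Algebra.algebraMap_eq_smul_one]
    simp
  | grade1 i =>
    rw [← ofLie_of, trFun_lie]
    simp only [adR_ofLie, map_sub, lie_trFun_mul, trFun_lie]
    abel
  | mul A B hA hB =>
    rw [adR_mul, hB, hA, lie_trFun_mul, map_add, map_add, adR_mul, MulOpposite.unop_add,
      LinearMap.add_apply, adR_mul, adR_mul]
    abel
  | add A B hA hB =>
    simp only [map_add, MulOpposite.unop_add, LinearMap.add_apply, hA, hB]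
    abel

theorem lie_mul_trFun (x : FL) (A B : UL) : trFun (ofLie x * A) B =
    trFun (ofLie x) (trFun A B) - trFun (trFun (ofLie x) A) B := by
  rw [eq_sub_iff_add_eq]
  induction B using FreeAlgebra.induction generalizing A with
  | grade0 r =>
    have h : aug (trFun (ofLie x) A) = 0 := by
      induction A using FreeAlgebra.induction with
      | grade0 r => rw [trFun_algebraMap, aug_ofLie]; simp
      | grade1 i => rw [← ofLie_of, trFun_lie, aug_ofLie]
      | mul A B hA hB => rw [lie_trFun_mul, map_add, map_mul, map_mul, hA, hB]; simp
      | add A B hA hB => rw [map_add, map_add, hA, hB, add_zero]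
    simp only [trFun_algebraMap, map_mul, h, aug_ofLie, map_smul, map_zero, smul_zero]
    simp
  | grade1 i =>
    have h : aug (trFun (ofLie x) A) = 0 := by
      induction A using FreeAlgebra.induction with
      | grade0 r => rw [trFun_algebraMap, aug_ofLie]; simp
      | grade1 i => rw [← ofLie_of, trFun_lie, aug_ofLie]
      | mul A B hA hB => rw [lie_trFun_mul, map_add, map_mul, map_mul, hA, hB]; simp
      | add A B hA hB => rw [map_add, map_add, hA, hB, add_zero]
    fin_cases i
    · simp [trFun_ι_zero, h, aug_ofLie]
    · simp only [Fin.mk_one, trFun_ι_one, adR_mul, adR_trFun, adR_ofLie]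
  | mul B C hB hC =>
    have key : ∀ t : UL ⊗[ℚ] UL,
        TensorProduct.map (trFun.flip B) (trFun.flip C)
          ((ofLie x ⊗ₜ[ℚ] 1 + 1 ⊗ₜ[ℚ] ofLie x) * t) +
        TensorProduct.map (trFun.flip B) (trFun.flip C)
          (((trFun (ofLie x)).rTensor UL + (trFun (ofLie x)).lTensor UL) t) =
        ((trFun (ofLie x)).rTensor UL + (trFun (ofLie x)).lTensor UL)
          (TensorProduct.map (trFun.flip B) (trFun.flip C) t) := by
      intro t
      induction t with
      | zero => simp
      | add s t hs ht =>
        rw [mul_add, map_add, map_add, map_add, map_add, map_add, ← hs, ← ht]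
        abel
      | tmul a b =>
        simp only [add_mul, Algebra.TensorProduct.tmul_mul_tmul, one_mul, LinearMap.add_apply,
          LinearMap.rTensor_tmul, LinearMap.lTensor_tmul, map_add, TensorProduct.map_tmul,
          LinearMap.flip_apply, ← hB, ← hC, TensorProduct.add_tmul, TensorProduct.tmul_add]
        abel
    have hD : ∀ t : UL ⊗[ℚ] UL, trFun (ofLie x) (LinearMap.mul' ℚ UL t) = LinearMap.mul' ℚ UL
        (((trFun (ofLie x)).rTensor UL + (trFun (ofLie x)).lTensor UL) t) := by
      intro t
      induction t with
      | zero => simp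
      | add s t hs ht => rw [map_add, map_add, hs, ht, map_add, map_add]
      | tmul a b => simp [lie_trFun_mul]
    rw [trFun_mul, trFun_mul, trFun_mul, map_mul, delta_ofLie, delta_lie_trFun, hD, ← key, map_add]
  | add B C hB hC =>
    simp only [map_add, ← hB, ← hC]
    abel

theorem isExtension_trFun : IsExtension trFun where
  tr_lie := trFun_lie
  lie_one := lie_trFun_one
  one_tr := one_trFun
  lie_mul_tr x y A := lie_mul_trFun x A (ofLie y)
  tr_mul := trFun_mul

/-- The span of the products of `n` elements of the Lie algebra. -/
noncomputable def lieProd (n : ℕ) : Submodule ℚ UL :=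
  Submodule.span ℚ {A | ∃ l : List FL, l.length = n ∧ (l.map ofLie).prod = A}

theorem lie_trFun_mem (x : FL) (n : ℕ) (A : UL) (hA : A ∈ lieProd n) :
    trFun (ofLie x) A ∈ lieProd n := by
  refine Submodule.span_induction (p := fun A _ => trFun (ofLie x) A ∈ lieProd n) ?_ ?_ ?_ ?_ hA
  · rintro _ ⟨l, hl, rfl⟩
    clear hA
    induction l generalizing n with
    | nil => simp [lie_trFun_one]
    | cons y l ih =>
      obtain ⟨m, rfl⟩ : ∃ m, n = m + 1 := ⟨l.length, by simpa using hl.symm⟩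
      have ih' := ih m (by simpa using hl)
      rw [List.map_cons, List.prod_cons, lie_trFun_mul, trFun_lie]
      refine Submodule.add_mem _ (Submodule.subset_span ⟨FL.tri x y :: l, by simpa using hl, by simp⟩) ?_
      refine Submodule.span_induction (p := fun B _ => ofLie y * B ∈ lieProd (m + 1))
        ?_ ?_ ?_ ?_ ih'
      · rintro _ ⟨k, hk, rfl⟩
        exact Submodule.subset_span ⟨y :: k, by simp [hk], by simp⟩
      · simp
      · intro B C _ _ hB hC
        rw [mul_add]
        exact Submodule.add_mem _ hB hC
      · intro r B _ hB
        rw [mul_smul_comm]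
        exact Submodule.smul_mem _ r hB
  · simp
  · intro B C _ _ hB hC
    rw [map_add]
    exact Submodule.add_mem _ hB hC
  · intro r B _ hB
    rw [map_smul]
    exact Submodule.smul_mem _ r hB

theorem induction_lieProd (A : UL) {P : UL → Prop} (h : ∀ n, ∀ A ∈ lieProd n, P A)
    (hadd : ∀ x y, P x → P y → P (x + y)) : P A := by
  have key : ∀ w : FreeMonoid Letter, ∀ r : ℚ,
      P (FreeAlgebra.equivMonoidAlgebraFreeMonoid.symm (MonoidAlgebra.single w r)) := by
    intro w r
    refine h w.toList.length _ ?_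
    have : FreeAlgebra.equivMonoidAlgebraFreeMonoid.symm (MonoidAlgebra.single w r) =
        r • ((w.toList.map (FreeLieAlgebra.of ℚ)).map ofLie).prod := by
      have h1 : FreeAlgebra.equivMonoidAlgebraFreeMonoid.symm (MonoidAlgebra.single w r) =
          MonoidAlgebra.lift ℚ UL (FreeMonoid Letter) (FreeMonoid.lift (FreeAlgebra.ι ℚ))
            (MonoidAlgebra.single w r) := rfl
      rw [h1, MonoidAlgebra.lift_single, FreeMonoid.lift_apply, List.map_map]
      congr 3
      funext i
      exact (ofLie_of i).symm
    rw [this]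
    exact Submodule.smul_mem _ r (Submodule.subset_span ⟨_, by simp, rfl⟩)
  rw [← FreeAlgebra.equivMonoidAlgebraFreeMonoid.symm_apply_apply A]
  induction FreeAlgebra.equivMonoidAlgebraFreeMonoid A using MonoidAlgebra.induction_linear with
  | zero => simpa using key 1 0
  | add f g hf hg => rw [map_add]; exact hadd _ _ hf hg
  | single w r => exact key w r

theorem IsExtension.eq_trFun {tr : UL →ₗ[ℚ] UL →ₗ[ℚ] UL} (h : IsExtension tr) : tr = trFun := by
  have hlie : ∀ (x : FL) (B : UL), tr (ofLie x) B = trFun (ofLie x) B := by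
    intro x B
    induction B using FreeAlgebra.induction with
    | grade0 r =>
      rw [Algebra.algebraMap_eq_smul_one, map_smul, map_smul, h.lie_one, lie_trFun_one]
    | grade1 i => rw [← ofLie_of, h.tr_lie, trFun_lie]
    | mul B C hB hC => rw [lie_tr_mul h.one_tr h.tr_mul, lie_trFun_mul, hB, hC]
    | add B C hB hC => rw [map_add, map_add, hB, hC]
  have hn : ∀ (n : ℕ), ∀ A ∈ lieProd n, ∀ y : FL, tr A (ofLie y) = trFun A (ofLie y) := by
    intro n
    induction n with
    | zero =>
      intro A hA y
      refine Submodule.span_induction (p := fun A _ => tr A (ofLie y) = trFun A (ofLie y))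
        ?_ ?_ ?_ ?_ hA
      · rintro _ ⟨l, hl, rfl⟩
        simp [List.length_eq_zero_iff.mp hl, h.one_tr, one_trFun]
      · simp
      · intro A B _ _ hA hB
        simp [hA, hB]
      · intro r A _ hA
        simp [hA]
    | succ n ih =>
      intro A hA y
      refine Submodule.span_induction (p := fun A _ => tr A (ofLie y) = trFun A (ofLie y))
        ?_ ?_ ?_ ?_ hA
      · rintro _ ⟨l, hl, rfl⟩
        rcases l with _ | ⟨x, l⟩
        · simp at hl
        have hl' : (l.map ofLie).prod ∈ lieProd n :=
          Submodule.subset_span ⟨l, by simpa using hl, rfl⟩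
        rw [List.map_cons, List.prod_cons, h.lie_mul_tr, lie_mul_trFun, ih _ hl', hlie, hlie,
          ih _ (lie_trFun_mem x n _ hl')]
      · simp
      · intro A B _ _ hA hB
        simp [hA, hB]
      · intro r A _ hA
        simp [hA]
  have hι : ∀ (A : UL) (i : Letter), tr A (FreeAlgebra.ι ℚ i) = trFun A (FreeAlgebra.ι ℚ i) := by
    intro A i
    refine induction_lieProd A (P := fun A => tr A (FreeAlgebra.ι ℚ i) = trFun A (FreeAlgebra.ι ℚ i))
      (fun n A hA => ?_) (fun A B hA hB => ?_)
    · rw [← ofLie_of]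
      exact hn n A hA _
    · simp [hA, hB]
  have hone : ∀ A : UL, tr A 1 = trFun A 1 := by
    intro A
    have hflip : tr.flip (FreeAlgebra.ι ℚ 0) = trFun.flip (FreeAlgebra.ι ℚ 0) :=
      LinearMap.ext fun A => hι A 0
    have hx : LinearMap.toSpanSingleton ℚ UL (FreeAlgebra.ι ℚ 0) ∘ₗ aug.toLinearMap =
        trFun.flip (FreeAlgebra.ι ℚ 0) :=
      LinearMap.ext fun A => (trFun_ι_zero A).symm
    have h1 := h.tr_mul A 1 (FreeAlgebra.ι ℚ 0)
    have h2 : ∀ t : UL ⊗[ℚ] UL,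
        LinearMap.mul' ℚ UL (TensorProduct.map (tr.flip 1) (trFun.flip (FreeAlgebra.ι ℚ 0)) t) =
        tr (TensorProduct.rid ℚ UL (aug.toLinearMap.lTensor UL t)) 1 * FreeAlgebra.ι ℚ 0 := by
      intro t
      induction t with
      | zero => simp
      | add s t hs ht => simp only [map_add, hs, ht, LinearMap.add_apply, add_mul]
      | tmul a b => simp [trFun_ι_zero]
    have h3 : TensorProduct.rid ℚ UL (aug.toLinearMap.lTensor UL (delta A)) = A := by
      have : aug.toLinearMap.lTensor UL (delta A) = A ⊗ₜ[ℚ] 1 :=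
        Coalgebra.lTensor_counit_comul (R := ℚ) A
      rw [this]
      simp
    rw [one_mul, hflip, h2, h3, hι, trFun_ι_zero] at h1
    have h4 : (tr A 1 - algebraMap ℚ UL (aug A)) * FreeAlgebra.ι ℚ 0 = 0 := by
      rw [sub_mul, ← h1, Algebra.smul_def, sub_self]
    rcases mul_eq_zero.mp h4 with h5 | h5
    · rw [trFun_one, sub_eq_zero.mp h5]
    · exact absurd h5 (FreeAlgebra.ι_ne_zero 0)
  refine LinearMap.ext fun A => LinearMap.ext fun B => ?_
  induction B using FreeAlgebra.induction generalizing A with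
  | grade0 r => rw [Algebra.algebraMap_eq_smul_one, map_smul, map_smul, hone]
  | grade1 i => exact hι A i
  | mul B C hB hC =>
    rw [h.tr_mul, trFun_mul, show tr.flip B = trFun.flip B from LinearMap.ext hB,
      show tr.flip C = trFun.flip C from LinearMap.ext hC]
  | add B C hB hC => rw [map_add, map_add, hB, hC]

theorem existsUnique_isExtension : ∃! tr : UL →ₗ[ℚ] UL →ₗ[ℚ] UL, IsExtension tr :=
  ⟨trFun, isExtension_trFun, fun _ h => h.eq_trFun⟩

/-- The extension `A ▷ B` of the post-Lie product to the enveloping algebra, the unique bilinear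
map satisfying the rules of `IsExtension`. -/
noncomputable def tr : UL →ₗ[ℚ] UL →ₗ[ℚ] UL := existsUnique_isExtension.choose

theorem isExtension_tr : IsExtension tr := existsUnique_isExtension.choose_spec.1

/-- The Grossman–Larson product `A ⊛ B = A₍₁₎ (A₍₂₎ ▷ B)`. -/
noncomputable def grossmanLarson (A B : UL) : UL :=
  LinearMap.mul' ℚ UL ((tr.flip B).lTensor UL (delta A))

/-- The coefficient of the word `w`. -/
noncomputable def coeff (w : Word) (A : UL) : ℚ :=
  (FreeAlgebra.equivMonoidAlgebraFreeMonoid A).coeff (FreeMonoid.ofList w)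

/-- A word as an element of the enveloping algebra. -/
noncomputable def word (w : Word) : UL := (w.map (FreeAlgebra.ι ℚ)).prod

end UL

/-! ### Completed series -/

/-- The completion of the enveloping algebra with respect to the weight: noncommutative formal
power series `∑ φ(w) w` in `x₀, x₁`, given by their coefficients. -/
abbrev Series : Type := Word → ℚ

namespace Series

/-- The pairing `(φ | f)` of a series with an element of `ℚ⟨x₀,x₁⟩`; on a word `w` it is the
coefficient of `w` in `φ`. -/
noncomputable def pair (φ : Series) : QX →ₗ[ℚ] ℚ := QX.basis.constr ℚ φ

/-- The pairing `(φ ⊗ ψ | f ⊗ g) = (φ | f) (ψ | g)`. -/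
noncomputable def pairTensor (φ ψ : Series) : QX ⊗[ℚ] QX →ₗ[ℚ] ℚ :=
  LinearMap.mul' ℚ ℚ ∘ₗ TensorProduct.map (pair φ) (pair ψ)

/-- The completed coproduct `Δ(φ) = ∑_{u,v} (φ | u ш v) u ⊗ v`, as the family of its
coefficients. -/
noncomputable def coproduct (φ : Series) (u v : Word) : ℚ :=
  pair φ (QX.word u * QX.word v)

/-- The coefficients of `φ ⊗ ψ`. -/
def tensor (φ ψ : Series) (u v : Word) : ℚ := φ u * ψ v

/-- Grouplike series: `φ ≠ 0` and `Δ(φ) = φ ⊗ φ`. -/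
def IsGrouplike (φ : Series) : Prop := φ ≠ 0 ∧ coproduct φ = tensor φ φ

/-- The truncation of a series at weight `N`, the sum of `φ(w) w` over the words `w` with at most
`N` letters. -/
noncomputable def trunc (N : ℕ) (φ : Series) : UL :=
  ∑ n ∈ Finset.range (N + 1), ∑ u : Fin n → Letter, φ (List.ofFn u) • UL.word (List.ofFn u)

/-- The Grossman–Larson product, extended to the completion. As it respects the weight, the
coefficient of a word `w` with `n` letters in `φ ⊛ ψ` depends only on the truncations of `φ` and
`ψ` at weight `n`. -/
noncomputable def grossmanLarson (φ ψ : Series) : Series := fun w =>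
  UL.coeff w (UL.grossmanLarson (trunc w.length φ) (trunc w.length ψ))

end Series

end Goncharov

/-!
The whole theorem is a statement of duality. The free associative algebra `UL` is paired with
`ℚ⟨x₀,x₁⟩` so that the words form dual bases (`UL.pairing`); the shuffle product is then dual to the
coproduct `Δ` of `UL` (`UL.pairing_shuffle`), and the central result `UL.pairing₂_gon` says that the
Goncharov coproduct is dual to the Grossman–Larson product:
`⟨A ⊛ B, f⟩ = ⟨A ⊗ B, Δ_Gon(f)⟩` for all `A`, `B` in `UL` and all `f`.

For the proof of this duality, work in the convolution algebra of linear maps `UL → UL`, where `A`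
becomes the generic grouplike element `g` (the identity map), with left inverse the antipode. There
`A ▷ x₀` becomes `x₀` and `A ▷ x₁` becomes `g⁻¹ x₁ g`, so that `A ⊛ x_{v₁}⋯x_{v_k}` becomes a
product of the letters `x_{v_p}`, separated by factors `g`, `g⁻¹` or `1`. The factor between the
letters `a` and `b` depends only on `(a, b)`, with `x₁` as the letter in front, and it is dual to
`f ↦ I(a; f; b)` (`UL.pairing_convIter`, `UL.glWord_cons`). Reading off the coefficient of a word
amounts to choosing the positions of the letters `x_{v_p}` in it; the sum over these choices is the
Goncharov coproduct, for which `QX.gonAux` gives a matching recursion along the word.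

A series may be truncated at the weight of the word it is paired with, because `Δ_Gon` respects the
weight (`QX.gon_mem_tensorWeightPart`). This gives the formula for `G ⊛ H`.

Since the words of `UL` separate the points of `ℚ⟨x₀,x₁⟩` and of its tensor powers, the bialgebra
axioms for `Δ_Gon` follow from those for `⊛`: associativity (`UL.gl_assoc`) and compatibility with
`Δ` (`UL.delta_gl`). For `x` in the Lie algebra, `A ↦ x ⊛ A = x A + x ▷ A` commutes with right
`⊛`-multiplication and is a coderivation, and these operators generate `UL` from `1`
(`UL.induction_glLie`). Finally the antipode exists because the bialgebra is graded and connected: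
the geometric series for the convolution inverse of the identity is locally finite.
-/

namespace Goncharov

/-! ### The pairing between the enveloping algebra and `ℚ⟨x₀,x₁⟩` -/

namespace QX

theorem linearMap_ext {M : Type*} [AddCommMonoid M] [Module ℚ M] {f g : QX →ₗ[ℚ] M}
    (h : ∀ w, f (word w) = g (word w)) : f = g :=
  basis.ext h

/-- Deletion of the first letter: `a w ↦ w`, and `w ↦ 0` if `w` does not begin with `a`. -/
noncomputable def leftDel (a : Letter) : QX →ₗ[ℚ] QX :=
  basis.constr ℚ fun
    | [] => 0
    | b :: w => if b = a then word w else 0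

@[simp] theorem leftDel_nil (a : Letter) : leftDel a (word []) = 0 :=
  basis.constr_basis ℚ _ _

@[simp] theorem leftDel_one (a : Letter) : leftDel a (1 : QX) = 0 :=
  leftDel_nil a

@[simp] theorem leftDel_word_cons (a b : Letter) (w : Word) :
    leftDel a (word (b :: w)) = if b = a then word w else 0 :=
  basis.constr_basis ℚ _ _

@[simp] theorem leftDel_cons (a b : Letter) (x : QX) :
    leftDel a (cons b x) = if b = a then x else 0 := by
  induction x using induction_word with
  | h w => simp
  | hadd x y hx hy => simp only [map_add, hx, hy]; split_ifs <;> simp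
  | hsmul r x hx => simp only [map_smul, hx]; split_ifs <;> simp

/-- Deletion of the first letter is a derivation of the shuffle product. -/
theorem leftDel_shuffle (a : Letter) (x y : QX) :
    leftDel a (x * y) = leftDel a x * y + x * leftDel a y := by
  induction x using induction_word with
  | hadd x x' hx hx' => simp only [map_add, add_mul, hx, hx']; abel
  | hsmul r x hx => simp only [map_smul, smul_mul_assoc, hx, smul_add]
  | h u =>
  induction y using induction_word with
  | hadd x x' hx hx' => simp only [map_add, mul_add, hx, hx']; abel
  | hsmul r x hx => simp only [map_smul, mul_smul_comm, hx, smul_add]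
  | h v =>
  rcases u with _ | ⟨b, u⟩
  · simp [← one_def]
  rcases v with _ | ⟨c, v⟩
  · simp [← one_def]
  rw [← cons_word, ← cons_word, mul_def, shuffle_cons_cons]
  simp only [map_add, leftDel_cons, mul_def]
  split_ifs <;> simp

@[simp] theorem constCoeff_word (w : Word) : constCoeff (word w) = if w = [] then 1 else 0 := by
  classical
  simp [constCoeff, word, Finsupp.single_apply]

@[simp] theorem constCoeff_one : constCoeff (1 : QX) = 1 := by simp [one_def]

@[simp] theorem constCoeff_cons (a : Letter) (x : QX) : constCoeff (cons a x) = 0 := by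
  induction x using induction_word with
  | h w => simp
  | hadd x y hx hy => simp [hx, hy]
  | hsmul r x hx => simp [hx]

theorem constCoeff_shuffle (x y : QX) : constCoeff (x * y) = constCoeff x * constCoeff y := by
  induction x using induction_word with
  | hadd x x' hx hx' => simp only [map_add, add_mul, hx, hx']
  | hsmul r x hx => simp only [map_smul, smul_mul_assoc, hx]
  | h u =>
  induction y using induction_word with
  | hadd x x' hx hx' => simp only [map_add, mul_add, hx, hx']
  | hsmul r x hx => simp only [map_smul, mul_smul_comm, hx]
  | h v =>
  rcases u with _ | ⟨b, u⟩
  · simp [← one_def]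
  rcases v with _ | ⟨c, v⟩
  · simp [← one_def]
  rw [← cons_word, ← cons_word, mul_def, shuffle_cons_cons]
  simp

end QX

namespace UL

/-- Induction along left multiplication by letters. -/
theorem induction_left {P : UL → Prop} (h1 : P 1) (hι : ∀ i A, P A → P (FreeAlgebra.ι ℚ i * A))
    (hadd : ∀ A B, P A → P B → P (A + B)) (hsmul : ∀ (r : ℚ) A, P A → P (r • A)) (A : UL) :
    P A := by
  suffices h : ∀ B, P B → P (A * B) by simpa using h 1 h1
  induction A using FreeAlgebra.induction with
  | grade0 r => intro B hB; simpa [← Algebra.smul_def] using hsmul r B hB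
  | grade1 i => exact fun B hB => hι i B hB
  | mul A C hA hC => intro B hB; rw [mul_assoc]; exact hA _ (hC _ hB)
  | add A C hA hC => intro B hB; rw [add_mul]; exact hadd _ _ (hA _ hB) (hC _ hB)

@[simp] theorem word_nil : word [] = 1 := rfl

@[simp] theorem word_cons (a : Letter) (w : Word) : word (a :: w) = FreeAlgebra.ι ℚ a * word w :=
  List.prod_cons

theorem word_append (u v : Word) : word (u ++ v) = word u * word v := by
  simp [word]

theorem span_word : Submodule.span ℚ (Set.range word) = ⊤ := by
  refine Submodule.eq_top_iff'.mpr fun A => ?_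
  induction A using induction_left with
  | h1 => exact Submodule.subset_span ⟨[], rfl⟩
  | hι i A hA =>
    induction hA using Submodule.span_induction with
    | mem _ h =>
      obtain ⟨w, rfl⟩ := h
      exact Submodule.subset_span ⟨i :: w, word_cons i w⟩
    | zero => simp
    | add x y _ _ hx hy => rw [mul_add]; exact add_mem hx hy
    | smul r x _ hx => rw [mul_smul_comm]; exact Submodule.smul_mem _ r hx
  | hadd A B hA hB => exact add_mem hA hB
  | hsmul r A hA => exact Submodule.smul_mem _ r hA

theorem linearMap_ext {M : Type*} [AddCommMonoid M] [Module ℚ M] {f g : UL →ₗ[ℚ] M}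
    (h : ∀ w, f (word w) = g (word w)) : f = g :=
  LinearMap.ext_on_range span_word h

/-- The right action of the enveloping algebra on `ℚ⟨x₀,x₁⟩` in which the letters act by deletion
of the first letter. -/
noncomputable def act : UL →ₐ[ℚ] (Module.End ℚ QX)ᵐᵒᵖ :=
  FreeAlgebra.lift ℚ fun i => MulOpposite.op (QX.leftDel i)

/-- The pairing `⟨A, f⟩` of the enveloping algebra with `ℚ⟨x₀,x₁⟩`, for which the words form dual
bases (see `pairing_word`). -/
noncomputable def pairing : UL →ₗ[ℚ] QX →ₗ[ℚ] ℚ :=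
  LinearMap.mk₂ ℚ (fun A f => QX.constCoeff ((act A).unop f)) (by simp) (by simp) (by simp)
    (by simp)

@[simp] theorem pairing_one (f : QX) : pairing 1 f = QX.constCoeff f := by simp [pairing]

@[simp] theorem pairing_ι_mul (i : Letter) (A : UL) (f : QX) :
    pairing (FreeAlgebra.ι ℚ i * A) f = pairing A (QX.leftDel i f) := by
  simp [pairing, act]

theorem pairing_word (v w : Word) : pairing (word v) (QX.word w) = if v = w then 1 else 0 := by
  induction v generalizing w with
  | nil => simp [eq_comm]
  | cons a v ih =>
    rcases w with _ | ⟨b, w⟩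
    · simp
    · rw [word_cons, pairing_ι_mul, QX.leftDel_word_cons]
      by_cases h : b = a
      · simp [h, ih]
      · simp [h, Ne.symm h]

theorem pairing_word_left (v : Word) (f : QX) : pairing (word v) f = QX.basis.coord v f := by
  classical
  have : pairing (word v) = QX.basis.coord v := QX.linearMap_ext fun w => by
    rw [pairing_word, QX.word, Module.Basis.coord_apply, Module.Basis.repr_self,
      Finsupp.single_apply]
    simp only [eq_comm]
  rw [this]

theorem coeff_eq_pairing (w : Word) (A : UL) : coeff w A = pairing A (QX.word w) := by
  classical
  let F : UL →ₗ[ℚ] ℚ :=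
    { toFun := coeff w
      map_add' := fun A B => by simp [coeff]
      map_smul' := fun r A => by simp [coeff] }
  have : F = pairing.flip (QX.word w) := linearMap_ext fun v => by
    rw [LinearMap.flip_apply, pairing_word]
    change (FreeAlgebra.equivMonoidAlgebraFreeMonoid (word v)).coeff (FreeMonoid.ofList w) = _
    have h : FreeAlgebra.equivMonoidAlgebraFreeMonoid (word v) =
        MonoidAlgebra.single (FreeMonoid.ofList v) (1 : ℚ) := by
      induction v with
      | nil => simp [MonoidAlgebra.one_def]
      | cons a v ih =>
        rw [word_cons, map_mul, ih, FreeMonoid.ofList_cons]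
        simp [FreeAlgebra.equivMonoidAlgebraFreeMonoid, MonoidAlgebra.single_mul_single]
    rw [h]
    simp [Finsupp.single_apply]
  exact LinearMap.congr_fun this A

/-- The shuffle product is dual to the coproduct of the enveloping algebra. -/
theorem pairing_shuffle (A : UL) (f g : QX) : pairing A (f * g) =
    LinearMap.mul' ℚ ℚ (TensorProduct.map (pairing.flip f) (pairing.flip g) (delta A)) := by
  induction A using induction_left generalizing f g with
  | h1 => simp [Algebra.TensorProduct.one_def, QX.constCoeff_shuffle]
  | hι i A hA =>
    have key : ∀ t : UL ⊗[ℚ] UL, TensorProduct.map (pairing.flip f) (pairing.flip g)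
        ((FreeAlgebra.ι ℚ i ⊗ₜ[ℚ] 1 + 1 ⊗ₜ[ℚ] FreeAlgebra.ι ℚ i) * t) =
        TensorProduct.map (pairing.flip (QX.leftDel i f)) (pairing.flip g) t +
        TensorProduct.map (pairing.flip f) (pairing.flip (QX.leftDel i g)) t := by
      intro t
      induction t with
      | zero => simp
      | add s t hs ht => rw [mul_add, map_add, hs, ht, map_add, map_add]; abel
      | tmul a b => simp [add_mul]
    rw [pairing_ι_mul, QX.leftDel_shuffle, map_add, hA, hA, map_mul, delta_ι, key, map_add]
  | hadd A B hA hB => simp only [map_add, LinearMap.add_apply, hA, hB]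
  | hsmul r A hA => simp only [map_smul, LinearMap.smul_apply, hA]

/-- The pairing of `A ⊗ B` with an element of `ℚ⟨x₀,x₁⟩ ⊗ ℚ⟨x₀,x₁⟩`, bilinear in `A` and `B`. -/
noncomputable def pairing₂ (t : QX ⊗[ℚ] QX) : UL →ₗ[ℚ] UL →ₗ[ℚ] ℚ :=
  LinearMap.mk₂ ℚ
    (fun A B => LinearMap.mul' ℚ ℚ (TensorProduct.map (pairing A) (pairing B) t))
    (by simp [TensorProduct.map_add_left]) (by simp [TensorProduct.map_smul_left])
    (by simp [TensorProduct.map_add_right]) (by simp [TensorProduct.map_smul_right])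

@[simp] theorem pairing₂_tmul (f g : QX) (A B : UL) :
    pairing₂ (f ⊗ₜ[ℚ] g) A B = pairing A f * pairing B g := by simp [pairing₂]

@[simp] theorem pairing₂_zero : pairing₂ 0 = 0 := by
  ext
  simp [pairing₂]

theorem pairing₂_add (s t : QX ⊗[ℚ] QX) : pairing₂ (s + t) = pairing₂ s + pairing₂ t := by
  refine LinearMap.ext fun A => LinearMap.ext fun B => ?_
  simp [pairing₂]

theorem pairing₂_smul (r : ℚ) (t : QX ⊗[ℚ] QX) : pairing₂ (r • t) = r • pairing₂ t := by
  refine LinearMap.ext fun A => LinearMap.ext fun B => ?_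
  simp [pairing₂]

theorem pairing_ext {f g : QX} (h : ∀ A, pairing A f = pairing A g) : f = g :=
  QX.basis.ext_elem fun w => by
    simpa only [pairing_word_left, Module.Basis.coord_apply] using h (word w)

theorem pairing₂_ext {s t : QX ⊗[ℚ] QX} (h : ∀ A B, pairing₂ s A B = pairing₂ t A B) : s = t := by
  refine (QX.basis.tensorProduct QX.basis).ext_elem fun ⟨v, w⟩ => ?_
  have key : ∀ t : QX ⊗[ℚ] QX, (QX.basis.tensorProduct QX.basis).repr t (v, w) =
      pairing₂ t (word v) (word w) := by
    intro t
    induction t with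
    | zero => simp
    | add s t hs ht => simp [pairing₂_add, hs, ht]
    | tmul f g => simp [pairing_word_left, mul_comm]
  rw [key, key, h]

/-- The pairing of `A ⊗ B ⊗ C` with an element of `ℚ⟨x₀,x₁⟩ ⊗ (ℚ⟨x₀,x₁⟩ ⊗ ℚ⟨x₀,x₁⟩)`. -/
noncomputable def pairing₃ (A B C : UL) : QX ⊗[ℚ] (QX ⊗[ℚ] QX) →ₗ[ℚ] ℚ :=
  LinearMap.mul' ℚ ℚ ∘ₗ TensorProduct.map (pairing A)
    (LinearMap.mul' ℚ ℚ ∘ₗ TensorProduct.map (pairing B) (pairing C))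

@[simp] theorem pairing₃_tmul (A B C : UL) (f : QX) (t : QX ⊗[ℚ] QX) :
    pairing₃ A B C (f ⊗ₜ[ℚ] t) = pairing A f * pairing₂ t B C := by
  simp [pairing₃, pairing₂]

theorem pairing₃_ext {s t : QX ⊗[ℚ] (QX ⊗[ℚ] QX)}
    (h : ∀ A B C, pairing₃ A B C s = pairing₃ A B C t) : s = t := by
  refine (QX.basis.tensorProduct (QX.basis.tensorProduct QX.basis)).ext_elem fun ⟨u, v, w⟩ => ?_
  have key : ∀ t : QX ⊗[ℚ] (QX ⊗[ℚ] QX),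
      (QX.basis.tensorProduct (QX.basis.tensorProduct QX.basis)).repr t (u, v, w) =
      pairing₃ (word u) (word v) (word w) t := by
    intro t
    induction t with
    | zero => simp
    | add s t hs ht => simp [hs, ht]
    | tmul f t =>
      induction t with
      | zero => simp
      | add s t hs ht => rw [TensorProduct.tmul_add, map_add, map_add, Finsupp.add_apply, hs, ht]
      | tmul g h => simp [pairing_word_left, mul_comm]
  rw [key, key, h]

end UL

/-! ### The Grossman–Larson product in the convolution algebra -/

namespace UL

open WithConv

theorem tr_eq_trFun : tr = trFun := isExtension_tr.eq_trFun

/-- The Grossman–Larson product as a bilinear map. -/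
noncomputable def gl : UL →ₗ[ℚ] UL →ₗ[ℚ] UL :=
  LinearMap.mk₂ ℚ (fun A B => LinearMap.mul' ℚ UL ((trFun.flip B).lTensor UL (delta A)))
    (by simp) (by simp) (by simp [LinearMap.lTensor_add]) (by simp [LinearMap.lTensor_smul])

theorem gl_apply (A B : UL) :
    gl A B = LinearMap.mul' ℚ UL ((trFun.flip B).lTensor UL (delta A)) := rfl

theorem grossmanLarson_eq_gl (A B : UL) : grossmanLarson A B = gl A B := by
  rw [grossmanLarson, tr_eq_trFun, gl_apply]

/-- The antipode of the enveloping algebra, the anti-automorphism with `xᵢ ↦ -xᵢ`. -/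
noncomputable def anti : UL →ₗ[ℚ] UL :=
  (MulOpposite.opLinearEquiv ℚ).symm.toLinearMap ∘ₗ
    (FreeAlgebra.lift ℚ fun i => MulOpposite.op (-FreeAlgebra.ι ℚ i : UL)).toLinearMap

@[simp] theorem anti_one : anti 1 = 1 := by simp [anti]

@[simp] theorem anti_ι_mul (i : Letter) (A : UL) :
    anti (FreeAlgebra.ι ℚ i * A) = -(anti A * FreeAlgebra.ι ℚ i) := by
  simp [anti]

theorem anti_word (w : Word) : anti (word w) = (-1 : ℚ) ^ w.length • word w.reverse := by
  induction w with
  | nil => simp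
  | cons a w ih => simp [ih, word_append, pow_succ]

theorem pairing_anti (A : UL) (f : QX) : pairing (anti A) f = pairing A (QX.antipode f) := by
  have : pairing ∘ₗ anti = pairing.compl₂ QX.antipode := linearMap_ext fun v =>
    QX.linearMap_ext fun w => by
      have h : QX.antipode (QX.word w) = (-1 : ℚ) ^ w.length • QX.word w.reverse :=
        QX.basis.constr_basis ℚ _ w
      simp only [LinearMap.comp_apply, LinearMap.compl₂_apply, anti_word, h, map_smul,
        LinearMap.smul_apply, pairing_word]
      by_cases hv : v.reverse = w
      · simp [← hv]
      · rw [if_neg hv, if_neg fun h => hv (by simp [h])]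
        simp
  exact LinearMap.congr_fun₂ this A f

@[simp] theorem aug_ι (i : Letter) : aug (FreeAlgebra.ι ℚ i) = 0 := by simp [aug]

theorem pairing_one_right (A : UL) : pairing A 1 = aug A := by
  induction A using induction_left with
  | h1 => simp
  | hι i A hA => simp
  | hadd A B hA hB => simp [hA, hB]
  | hsmul r A hA => simp [hA]

theorem conv_apply (f g : WithConv (UL →ₗ[ℚ] UL)) (A : UL) :
    (f * g).ofConv A = LinearMap.mul' ℚ UL (TensorProduct.map f.ofConv g.ofConv (delta A)) := rfl

theorem conv_ι_mul (f g : WithConv (UL →ₗ[ℚ] UL)) (i : Letter) (A : UL) :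
    (f * g).ofConv (FreeAlgebra.ι ℚ i * A) =
      (toConv (f.ofConv ∘ₗ LinearMap.mulLeft ℚ (FreeAlgebra.ι ℚ i)) * g).ofConv A +
      (f * toConv (g.ofConv ∘ₗ LinearMap.mulLeft ℚ (FreeAlgebra.ι ℚ i))).ofConv A := by
  simp only [conv_apply, map_mul, delta_ι, ← map_add]
  congr 1
  induction delta A with
  | zero => simp
  | add s t hs ht => simp only [mul_add, map_add, hs, ht]; abel
  | tmul a b => simp [add_mul]

/-- The identity of the enveloping algebra as an element of the convolution algebra. -/
noncomputable def convId : WithConv (UL →ₗ[ℚ] UL) := toConv LinearMap.id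

/-- The element `A ↦ ε(A) y` of the convolution algebra. -/
noncomputable def convConst (y : UL) : WithConv (UL →ₗ[ℚ] UL) :=
  toConv (LinearMap.toSpanSingleton ℚ UL y ∘ₗ aug.toLinearMap)

theorem convConst_mul (y : UL) (f : WithConv (UL →ₗ[ℚ] UL)) (A : UL) :
    (convConst y * f).ofConv A = y * f.ofConv A := by
  have h : ∀ t : UL ⊗[ℚ] UL, LinearMap.mul' ℚ UL (TensorProduct.map (convConst y).ofConv f.ofConv t)
      = y * f.ofConv (TensorProduct.lid ℚ UL (aug.toLinearMap.rTensor UL t)) := by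
    intro t
    induction t with
    | zero => simp
    | add s t hs ht => simp only [map_add, hs, ht, mul_add]
    | tmul a b => simp [convConst]
  have h2 : aug.toLinearMap.rTensor UL (delta A) = 1 ⊗ₜ[ℚ] A :=
    Coalgebra.rTensor_counit_comul (R := ℚ) A
  rw [conv_apply, h, h2]
  simp

theorem anti_mul_convId : toConv anti * convId = 1 := by
  refine ofConv_injective (LinearMap.ext fun A => ?_)
  change _ = algebraMap ℚ UL (aug A)
  induction A using induction_left with
  | h1 => rw [conv_apply, map_one, Algebra.TensorProduct.one_def]; simp [convId]
  | hι i A hA =>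
    rw [conv_ι_mul, conv_apply, conv_apply, map_mul, aug_ι, zero_mul, map_zero]
    induction delta A with
    | zero => simp
    | add s t hs ht => simp only [map_add]; rw [add_add_add_comm, hs, ht, add_zero]
    | tmul a b => simp [convId, mul_assoc]
  | hadd A B hA hB => simp only [map_add, hA, hB]
  | hsmul r A hA => rw [map_smul, hA, map_smul, smul_eq_mul, map_mul, ← Algebra.smul_def]

/-- The right adjoint action on `y`, as an element of the convolution algebra. -/
noncomputable def convAd (y : UL) : WithConv (UL →ₗ[ℚ] UL) :=
  toConv (LinearMap.mk₂ ℚ (fun A y => (adR A).unop y) (by simp) (by simp) (by simp) (by simp)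
    |>.flip y)

/-- `A₍₁₎ · ad_R(A₍₂₎)(y) = y A`. -/
theorem convId_mul_convAd (y : UL) : convId * convAd y = convConst y * convId := by
  refine ofConv_injective (LinearMap.ext fun A => ?_)
  rw [convConst_mul]
  change _ = y * A
  induction A using induction_left generalizing y with
  | h1 =>
    rw [conv_apply, map_one, Algebra.TensorProduct.one_def]
    simp [convId, convAd]
  | hι i A hA =>
    have h : toConv ((convAd y).ofConv ∘ₗ LinearMap.mulLeft ℚ (FreeAlgebra.ι ℚ i)) =
        convAd (y * FreeAlgebra.ι ℚ i - FreeAlgebra.ι ℚ i * y) := by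
      refine ofConv_injective (LinearMap.ext fun B => ?_)
      simp [convAd, adR]
    have h2 : toConv (convId.ofConv ∘ₗ LinearMap.mulLeft ℚ (FreeAlgebra.ι ℚ i)) =
        convConst (FreeAlgebra.ι ℚ i) * convId := by
      refine ofConv_injective (LinearMap.ext fun B => ?_)
      rw [convConst_mul]
      simp [convId]
    rw [conv_ι_mul, h, hA, h2, mul_assoc, convConst_mul, hA]
    noncomm_ring
  | hadd A B hA hB => simp only [map_add, hA, hB, mul_add]
  | hsmul r A hA => simp only [map_smul, hA, mul_smul_comm]

theorem trConv_ι_zero : trConv (FreeAlgebra.ι ℚ 0) = convConst (FreeAlgebra.ι ℚ 0) := by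
  simp [trConv, convConst]

theorem trConv_ι_one : trConv (FreeAlgebra.ι ℚ 1) = convAd (FreeAlgebra.ι ℚ 1) := by
  refine ofConv_injective (LinearMap.ext fun A => ?_)
  exact trFun_ι_one A

/-- `ad_R(A)(y) = S(A₍₁₎) y A₍₂₎`; for `y = x₁` this is `A ▷ x₁`. -/
theorem convAd_eq (y : UL) : convAd y = toConv anti * (convConst y * convId) := by
  rw [← convId_mul_convAd, ← mul_assoc, anti_mul_convId, one_mul]

/-- For `a = x₁` the map `A ↦ A ⊛ v`, for `a = x₀` the map `A ↦ A ▷ v`. -/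
noncomputable def glWord (a : Letter) (v : Word) : WithConv (UL →ₗ[ℚ] UL) :=
  (if a = 1 then convId else 1) * trConv (word v)

theorem glWord_one (v : Word) (A : UL) : (glWord 1 v).ofConv A = gl A (word v) := rfl

/-- The dual of `f ↦ I(a; f; b)`, see `pairing_convIter`. -/
noncomputable def convIter (a b : Letter) : WithConv (UL →ₗ[ℚ] UL) :=
  if a = b then 1 else if a = 1 then convId else toConv anti

theorem pairing_convIter (a b : Letter) (A : UL) (f : QX) :
    pairing ((convIter a b).ofConv A) f = pairing A (QX.iter a f b) := by
  rw [convIter, QX.iter]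
  split_ifs
  · change pairing (algebraMap ℚ UL (aug A)) f = _
    simp [Algebra.algebraMap_eq_smul_one, pairing_one_right, mul_comm]
  · rfl
  · exact pairing_anti A f

theorem glWord_nil (a : Letter) : glWord a [] = convIter a 0 := by
  fin_cases a <;> simp [glWord, convIter]

theorem glWord_cons (a b : Letter) (v : Word) :
    glWord a (b :: v) = convIter a b * (convConst (FreeAlgebra.ι ℚ b) * glWord b v) := by
  rw [glWord, glWord, word_cons, map_mul]
  fin_cases a <;> fin_cases b
  · simp [convIter, trConv_ι_zero]
  · simp [convIter, trConv_ι_one, convAd_eq, mul_assoc]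
  · simp [convIter, trConv_ι_zero]
  · simp only [convIter, Fin.mk_one, trConv_ι_one, if_true]
    rw [← mul_assoc, convId_mul_convAd, one_mul, mul_assoc]

end UL

/-! ### A recursion for the Goncharov coproduct -/

namespace QX

/-- The map `q ⊗ v ↦ (p ш q) ⊗ b v`. -/
noncomputable def step (p : QX) (b : Letter) : QX ⊗[ℚ] QX →ₗ[ℚ] QX ⊗[ℚ] QX :=
  TensorProduct.map (LinearMap.mulLeft ℚ p) (cons b)

@[simp] theorem step_tmul (p : QX) (b : Letter) (x y : QX) :
    step p b (x ⊗ₜ[ℚ] y) = (p * x) ⊗ₜ[ℚ] cons b y := rfl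

/-- The part of the Goncharov coproduct which belongs to a final segment of a word: `a` is the last
letter chosen so far, `u` the word of the letters skipped since then, and the third argument the
word of the letters still to come. -/
noncomputable def gonAux (a : Letter) (u : Word) : Word → QX ⊗[ℚ] QX
  | [] => iter a (word u) 0 ⊗ₜ[ℚ] 1
  | b :: w => gonAux a (u ++ [b]) w + step (iter a (word u) b) b (gonAux b [] w)

theorem extLetter_zero (w : Word) : extLetter w 0 = 1 := rfl

theorem extLetter_length_succ (w : Word) : extLetter w (w.length + 1) = 0 := by
  simp [extLetter]

theorem map_extLetter (w : Word) : (List.range' 1 w.length).map (extLetter w) = w := by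
  refine List.ext_getElem (by simp) fun i h₁ h₂ => ?_
  simp [extLetter, add_comm 1 i, h₂]

theorem quotWord_succ (w : Word) (i : ℕ) : quotWord w i (i + 1) = [] := by simp [quotWord]

theorem quotWord_append {i j : ℕ} (w : Word) (h : i < j) :
    quotWord w i (j + 1) = quotWord w i j ++ [extLetter w j] := by
  have h1 : j + 1 - i - 1 = (j - i - 1) + 1 := by omega
  have h2 : i + 1 + (j - i - 1) = j := by omega
  simp [quotWord, h1, List.range'_concat, h2]

/-- The sum over the index sequences in `[j, …, n]` which continue a sequence with last index `i`,
when the letters strictly between `i` and `j` have been skipped. The recursion is on the position `j`: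
either it is skipped as well, or it is the next index. -/
theorem sum_quotProd_eq_gonAux (w : Word) (m : ℕ) : ∀ i j : ℕ, i < j → j + m = w.length + 1 →
    ((List.range' j m).sublists'.map fun I =>
      (List.zipWith (fun p q => iter (extLetter w p) (word (quotWord w p q)) (extLetter w q))
        (i :: I) (I ++ [w.length + 1])).prod ⊗ₜ[ℚ] word (I.map (extLetter w))).sum =
    gonAux (extLetter w i) (quotWord w i j) ((List.range' j m).map (extLetter w)) := by
  induction m with
  | zero =>
    intro i j _ h
    have : j = w.length + 1 := h
    subst this
    simp [gonAux, extLetter_length_succ, ← one_def]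
  | succ m ih =>
    intro i j hij h
    have h1 := ih i (j + 1) (by omega) (by omega)
    have h2 := ih j (j + 1) (by omega) (by omega)
    rw [quotWord_append w hij] at h1
    rw [quotWord_succ] at h2
    rw [List.range'_succ, List.sublists'_cons, List.map_append, List.sum_append, h1, List.map_cons,
      gonAux, ← h2, map_list_sum, List.map_map, List.map_map]
    congr 3
    funext I
    simp

theorem gon_word (w : Word) : gon (word w) = gonAux 1 [] w := by
  have h := sum_quotProd_eq_gonAux w w.length 0 1 (by omega) (by omega)
  rw [map_extLetter, quotWord_succ, extLetter_zero] at h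
  rw [← h]
  exact basis.constr_basis ℚ _ w

end QX

/-! ### Duality of the Goncharov coproduct and the Grossman–Larson product -/

namespace UL

open WithConv

theorem pairing₂_step (p : QX) (b c : Letter) (t : QX ⊗[ℚ] QX) (A B : UL) :
    pairing₂ (QX.step p b t) A (FreeAlgebra.ι ℚ c * B) = if b = c then
      LinearMap.mul' ℚ ℚ (TensorProduct.map (pairing.flip p) ((pairing₂ t).flip B) (delta A))
    else 0 := by
  induction t with
  | zero =>
    have hflip : (pairing₂ 0).flip B = 0 := by ext; simp
    rw [hflip, TensorProduct.map_zero_right]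
    simp
  | add s t hs ht =>
    have hflip : (pairing₂ (s + t)).flip B = (pairing₂ s).flip B + (pairing₂ t).flip B := by
      rw [pairing₂_add]; rfl
    rw [map_add, pairing₂_add, LinearMap.add_apply, LinearMap.add_apply, hs, ht, hflip,
      TensorProduct.map_add_right]
    split_ifs <;> simp
  | tmul x y =>
    have hflip : (pairing₂ (x ⊗ₜ[ℚ] y)).flip B = pairing B y • pairing.flip x := by
      ext; simp [mul_comm]
    rw [QX.step_tmul, pairing₂_tmul, pairing_ι_mul, QX.leftDel_cons, pairing_shuffle, hflip,
      TensorProduct.map_smul_right]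
    split_ifs <;> simp [mul_comm]

/-- The functional `A ⊗ B ↦ ∑ ⟨A, u u'⟩ ⟨B, u''⟩`, where the sum runs over the factorizations
`w = u' c u''`. -/
noncomputable def splitForm (c : Letter) (u : Word) : Word → UL ⊗[ℚ] UL →ₗ[ℚ] ℚ
  | [] => 0
  | b :: w => splitForm c (u ++ [b]) w + if b = c then
      LinearMap.mul' ℚ ℚ ∘ₗ
        TensorProduct.map (pairing.flip (QX.word u)) (pairing.flip (QX.word w))
    else 0

theorem splitForm_cons_one (c b : Letter) (u w : Word) (B : UL) :
    splitForm c (b :: u) w (1 ⊗ₜ[ℚ] B) = 0 := by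
  induction w generalizing u with
  | nil => simp [splitForm]
  | cons d w ih =>
    rw [splitForm, LinearMap.add_apply, List.cons_append, ih]
    split_ifs <;> simp

theorem splitForm_cons_ι_mul (c b d : Letter) (u w : Word) (A B : UL) :
    splitForm c (b :: u) w ((FreeAlgebra.ι ℚ d * A) ⊗ₜ[ℚ] B) =
      if b = d then splitForm c u w (A ⊗ₜ[ℚ] B) else 0 := by
  induction w generalizing u with
  | nil => simp [splitForm]
  | cons e w ih =>
    rw [splitForm, LinearMap.add_apply, List.cons_append, ih, splitForm]
    split_ifs <;> simp [*]

theorem splitForm_nil_tmul (c : Letter) (w : Word) (A B : UL) :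
    splitForm c [] w (A ⊗ₜ[ℚ] B) = pairing (A * (FreeAlgebra.ι ℚ c * B)) (QX.word w) := by
  induction w generalizing A with
  | nil => simp [splitForm, ← QX.one_def, pairing_one_right]
  | cons b w ih =>
    rw [splitForm, LinearMap.add_apply, List.nil_append]
    induction A using induction_left with
    | h1 =>
      rw [splitForm_cons_one, one_mul, pairing_ι_mul]
      split_ifs <;> simp_all
    | hι d A hA =>
      rw [splitForm_cons_ι_mul, ih, mul_assoc, pairing_ι_mul]
      split_ifs <;> simp_all
    | hadd A A' hA hA' =>
      rw [TensorProduct.add_tmul, map_add, map_add, add_mul, map_add, LinearMap.add_apply, ← hA,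
        ← hA']
      abel
    | hsmul r A hA =>
      rw [← TensorProduct.smul_tmul', map_smul, map_smul, smul_mul_assoc, map_smul,
        LinearMap.smul_apply, ← hA, smul_add]

theorem splitForm_nil (c : Letter) (w : Word) (t : UL ⊗[ℚ] UL) :
    splitForm c [] w t = pairing (LinearMap.mul' ℚ UL
      ((LinearMap.mulLeft ℚ (FreeAlgebra.ι ℚ c)).lTensor UL t)) (QX.word w) := by
  induction t with
  | zero => simp
  | add s t hs ht => simp only [map_add, hs, ht, LinearMap.add_apply]
  | tmul A B => rw [splitForm_nil_tmul]; simp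

theorem pairing₂_gonAux_one (a : Letter) (u w : Word) (A : UL) :
    pairing₂ (QX.gonAux a u w) A 1 = pairing A (QX.iter a (QX.word (u ++ w)) 0) := by
  have hstep : ∀ (p : QX) (b : Letter) (t : QX ⊗[ℚ] QX), pairing₂ (QX.step p b t) A 1 = 0 := by
    intro p b t
    induction t with
    | zero => simp
    | add s t hs ht => rw [map_add, pairing₂_add, LinearMap.add_apply, LinearMap.add_apply, hs, ht,
        add_zero]
    | tmul x y => simp
  induction w generalizing u with
  | nil => simp [QX.gonAux]
  | cons b w ih =>
    rw [QX.gonAux, pairing₂_add, LinearMap.add_apply, LinearMap.add_apply, ih, hstep]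
    simp

/-- Both sides are computed by splitting off the first letter `c` of `v`: the possible positions of
`c` in `w` are the factorizations summed over in `splitForm`. -/
theorem pairing₂_gonAux (v : Word) : ∀ (a : Letter) (w : Word) (A : UL),
    pairing₂ (QX.gonAux a [] w) A (word v) = pairing ((glWord a v).ofConv A) (QX.word w) := by
  induction v with
  | nil =>
    intro a w A
    rw [word_nil, pairing₂_gonAux_one, glWord_nil, pairing_convIter, List.nil_append]
  | cons c v ih =>
    intro a w A
    have key : ∀ u : Word, pairing₂ (QX.gonAux a u w) A (word (c :: v)) = splitForm c u w
        (TensorProduct.map (convIter a c).ofConv (glWord c v).ofConv (delta A)) := by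
      induction w with
      | nil => intro u; simp [QX.gonAux, splitForm]
      | cons b w ihw =>
        intro u
        rw [QX.gonAux, pairing₂_add, LinearMap.add_apply, LinearMap.add_apply, ihw, word_cons,
          pairing₂_step, splitForm, LinearMap.add_apply]
        congr 1
        split_ifs with h
        · subst h
          have h1 : pairing.flip (QX.iter a (QX.word u) b) =
              pairing.flip (QX.word u) ∘ₗ (convIter a b).ofConv :=
            LinearMap.ext fun B => (pairing_convIter a b B _).symm
          have h2 : (pairing₂ (QX.gonAux b [] w)).flip (word v) =
              pairing.flip (QX.word w) ∘ₗ (glWord b v).ofConv :=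
            LinearMap.ext fun B => ih b w B
          rw [h1, h2, TensorProduct.map_comp]
          rfl
        · simp
    have hc : (convConst (FreeAlgebra.ι ℚ c) * glWord c v).ofConv =
        LinearMap.mulLeft ℚ (FreeAlgebra.ι ℚ c) ∘ₗ (glWord c v).ofConv :=
      LinearMap.ext fun B => convConst_mul _ _ B
    rw [key, splitForm_nil, glWord_cons, conv_apply, hc, ← LinearMap.comp_apply
      (LinearMap.lTensor UL _), LinearMap.lTensor_comp_map]

/-- The Goncharov coproduct is dual to the Grossman–Larson product. -/
theorem pairing₂_gon (A B : UL) (f : QX) : pairing₂ (QX.gon f) A B = pairing (gl A B) f := by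
  induction f using QX.induction_word with
  | hadd x y hx hy => rw [map_add, pairing₂_add, LinearMap.add_apply, LinearMap.add_apply, hx, hy,
      map_add]
  | hsmul r x hx => rw [map_smul, pairing₂_smul, LinearMap.smul_apply, LinearMap.smul_apply, hx,
      map_smul]
  | h w =>
    have : pairing₂ (QX.gon (QX.word w)) A = pairing.flip (QX.word w) ∘ₗ gl A :=
      linearMap_ext fun v => by
        rw [QX.gon_word, pairing₂_gonAux, glWord_one]
        rfl
    rw [this]
    rfl

end UL

/-! ### The Grossman–Larson product is associative and compatible with the coproduct -/

namespace UL

/-- Left Grossman–Larson multiplication by an element of the Lie algebra, `A ↦ x A + x ▷ A`. -/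
noncomputable def glLie (x : FL) : UL →ₗ[ℚ] UL :=
  LinearMap.mulLeft ℚ (ofLie x) + trFun (ofLie x)

theorem glLie_apply (x : FL) (A : UL) : glLie x A = ofLie x * A + trFun (ofLie x) A := rfl

/-- Left `⊛`-multiplication by a primitive element is a coderivation. -/
theorem delta_glLie (x : FL) (A : UL) :
    delta (glLie x A) = ((glLie x).rTensor UL + (glLie x).lTensor UL) (delta A) := by
  have h : ∀ t : UL ⊗[ℚ] UL, (ofLie x ⊗ₜ[ℚ] 1 + 1 ⊗ₜ[ℚ] ofLie x) * t =
      ((LinearMap.mulLeft ℚ (ofLie x)).rTensor UL +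
        (LinearMap.mulLeft ℚ (ofLie x)).lTensor UL) t := by
    intro t
    induction t with
    | zero => simp
    | add s t hs ht => rw [mul_add, hs, ht, map_add]
    | tmul a b => simp [add_mul]
  rw [glLie_apply, map_add, map_mul, delta_ofLie, delta_lie_trFun, h, glLie,
    LinearMap.rTensor_add, LinearMap.lTensor_add]
  simp only [LinearMap.add_apply]
  abel

/-- The operators `A ↦ x A + x ▷ A` generate the enveloping algebra from `1`, since
`x A = (x A + x ▷ A) - x ▷ A` and `x ▷ -` does not increase the degree in the Lie algebra. -/
theorem induction_glLie {P : UL → Prop} (h1 : P 1) (hlie : ∀ x A, P A → P (glLie x A))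
    (hadd : ∀ A B, P A → P B → P (A + B)) (hsmul : ∀ (r : ℚ) A, P A → P (r • A)) (A : UL) :
    P A := by
  have h0 : P 0 := by simpa using hsmul 0 1 h1
  have key : ∀ n, ∀ A ∈ lieProd n, P A := by
    intro n
    induction n with
    | zero =>
      intro A hA
      induction hA using Submodule.span_induction with
      | mem _ h =>
        obtain ⟨l, hl, rfl⟩ := h
        simpa [List.length_eq_zero_iff.mp hl] using h1
      | zero => exact h0
      | add A B _ _ hA hB => exact hadd A B hA hB
      | smul r A _ hA => exact hsmul r A hA
    | succ n ih =>
      intro A hA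
      induction hA using Submodule.span_induction with
      | mem _ h =>
        obtain ⟨l, hl, rfl⟩ := h
        rcases l with _ | ⟨x, l⟩
        · simp at hl
        have hl' : (l.map ofLie).prod ∈ lieProd n :=
          Submodule.subset_span ⟨l, by simpa using hl, rfl⟩
        have h : ofLie x * (l.map ofLie).prod = glLie x (l.map ofLie).prod +
            (-1 : ℚ) • trFun (ofLie x) (l.map ofLie).prod := by
          rw [glLie_apply, neg_one_smul, add_neg_cancel_right]
        rw [List.map_cons, List.prod_cons, h]
        exact hadd _ _ (hlie _ _ (ih _ hl')) (hsmul _ _ (ih _ (lie_trFun_mem x n _ hl')))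
      | zero => exact h0
      | add A B _ _ hA hB => exact hadd A B hA hB
      | smul r A _ hA => exact hsmul r A hA
  exact induction_lieProd A key hadd

@[simp] theorem one_gl (B : UL) : gl 1 B = B := by
  rw [gl_apply, map_one, Algebra.TensorProduct.one_def]
  simp [one_trFun]

/-- In Sweedler notation: `x ▷ -` is a derivation and a coderivation, and
`(x A + x ▷ A) ▷ B = x ▷ (A ▷ B)`. -/
theorem glLie_gl (x : FL) (A B : UL) : gl (glLie x A) B = glLie x (gl A B) := by
  rw [gl_apply, gl_apply, delta_glLie]
  induction delta A with
  | zero => simp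
  | add s t hs ht => simp only [map_add, hs, ht]
  | tmul a b =>
    have h : trFun (glLie x b) B = trFun (ofLie x) (trFun b B) := by
      rw [glLie_apply, map_add, LinearMap.add_apply, lie_mul_trFun, sub_add_cancel]
    simp only [LinearMap.add_apply, LinearMap.rTensor_tmul, LinearMap.lTensor_tmul, map_add,
      LinearMap.mul'_apply, LinearMap.flip_apply, h]
    rw [glLie_apply, glLie_apply, lie_trFun_mul, add_mul, mul_assoc, add_assoc]

@[simp] theorem gl_one (A : UL) : gl A 1 = A := by
  induction A using induction_glLie with
  | h1 => simp
  | hlie x A hA => rw [glLie_gl, hA]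
  | hadd A B hA hB => rw [map_add, LinearMap.add_apply, hA, hB]
  | hsmul r A hA => rw [map_smul, LinearMap.smul_apply, hA]

theorem gl_assoc (A B C : UL) : gl (gl A B) C = gl A (gl B C) := by
  induction A using induction_glLie with
  | h1 => simp
  | hlie x A hA => rw [glLie_gl, glLie_gl, glLie_gl, hA]
  | hadd A A' hA hA' => simp only [map_add, LinearMap.add_apply, hA, hA']
  | hsmul r A hA => simp only [map_smul, LinearMap.smul_apply, hA]

theorem delta_gl (A B : UL) :
    delta (gl A B) = TensorProduct.map₂ gl gl (delta A) (delta B) := by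
  induction A using induction_glLie with
  | h1 =>
    rw [one_gl, map_one, Algebra.TensorProduct.one_def]
    induction delta B with
    | zero => simp
    | add s t hs ht => rw [map_add, ← hs, ← ht]
    | tmul a b => simp
  | hlie x A hA =>
    rw [glLie_gl, delta_glLie, delta_glLie, hA]
    induction delta A with
    | zero => simp
    | add s t hs ht => simp only [map_add, LinearMap.add_apply] at hs ht ⊢; rw [← hs, ← ht]
    | tmul a b =>
      induction delta B with
      | zero => simp
      | add s t hs ht => simp only [map_add, hs, ht]
      | tmul c d => simp [glLie_gl]
  | hadd A A' hA hA' => simp only [map_add, LinearMap.add_apply, hA, hA']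
  | hsmul r A hA => simp only [map_smul, LinearMap.smul_apply, hA]

/-! ### The bialgebra structure, by duality -/

/-- The form `(A ⊗ B, A' ⊗ B') ↦ ⟨A ⊗ A', s⟩ ⟨B ⊗ B', t⟩`. -/
noncomputable def pairing₄ (s t : QX ⊗[ℚ] QX) : UL ⊗[ℚ] UL →ₗ[ℚ] UL ⊗[ℚ] UL →ₗ[ℚ] ℚ :=
  (TensorProduct.map₂ (pairing₂ s) (pairing₂ t)).compr₂ (LinearMap.mul' ℚ ℚ)

@[simp] theorem pairing₄_tmul (s t : QX ⊗[ℚ] QX) (A B A' B' : UL) :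
    pairing₄ s t (A ⊗ₜ[ℚ] B) (A' ⊗ₜ[ℚ] B') = pairing₂ s A A' * pairing₂ t B B' := by
  simp [pairing₄]

theorem pairing₄_gon (f g : QX) (X Y : UL ⊗[ℚ] UL) :
    pairing₄ (QX.gon f) (QX.gon g) X Y = LinearMap.mul' ℚ ℚ
      (TensorProduct.map (pairing.flip f) (pairing.flip g) (TensorProduct.map₂ gl gl X Y)) := by
  induction X with
  | zero => simp
  | add X X' hX hX' => simp only [map_add, LinearMap.add_apply, hX, hX']
  | tmul A B =>
    induction Y with
    | zero => simp
    | add Y Y' hY hY' => simp only [map_add, hY, hY']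
    | tmul A' B' => simp [pairing₂_gon]

theorem pairing₄_delta (s t : QX ⊗[ℚ] QX) (A B : UL) :
    pairing₄ s t (delta A) (delta B) = pairing₂ (s * t) A B := by
  have h0 : ∀ t : QX ⊗[ℚ] QX, pairing₄ 0 t = 0 := by
    intro t
    ext
    simp
  have h0' : ∀ s : QX ⊗[ℚ] QX, pairing₄ s 0 = 0 := by
    intro s
    ext
    simp
  have hadd : ∀ s s' t : QX ⊗[ℚ] QX, pairing₄ (s + s') t = pairing₄ s t + pairing₄ s' t := by
    intro s s' t
    ext
    simp [pairing₂_add, add_mul]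
  have hadd' : ∀ s t t' : QX ⊗[ℚ] QX, pairing₄ s (t + t') = pairing₄ s t + pairing₄ s t' := by
    intro s s' t
    ext
    simp [pairing₂_add, mul_add]
  induction s with
  | zero => simp [h0]
  | add s s' hs hs' =>
    rw [add_mul, hadd, pairing₂_add]
    simp only [LinearMap.add_apply, hs, hs']
  | tmul f g =>
    induction t with
    | zero => simp [h0']
    | add t t' ht ht' =>
      rw [mul_add, hadd', pairing₂_add]
      simp only [LinearMap.add_apply, ht, ht']
    | tmul f' g' =>
      rw [Algebra.TensorProduct.tmul_mul_tmul, pairing₂_tmul, pairing_shuffle, pairing_shuffle]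
      induction delta A with
      | zero => simp
      | add X X' hX hX' => simp only [map_add, LinearMap.add_apply, hX, hX', add_mul]
      | tmul a b =>
        induction delta B with
        | zero => simp
        | add X X' hX hX' => simp only [map_add, hX, hX', mul_add]
        | tmul c d => simp; ring

end UL

namespace QX

open UL

theorem gon_mul (f g : QX) : gon (f * g) = gon f * gon g := by
  refine pairing₂_ext fun A B => ?_
  rw [pairing₂_gon, pairing_shuffle, delta_gl, ← pairing₄_gon, pairing₄_delta]

theorem gon_one : gon 1 = 1 := by
  rw [one_def, gon_word]
  simp [gonAux, iter, ← one_def, Algebra.TensorProduct.one_def]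

/-- The Goncharov coproduct as a morphism of algebras. -/
noncomputable def gonHom : QX →ₐ[ℚ] QX ⊗[ℚ] QX :=
  AlgHom.ofLinearMap gon gon_one gon_mul

/-- The constant coefficient as a morphism of algebras. -/
noncomputable def counitHom : QX →ₐ[ℚ] ℚ :=
  AlgHom.ofLinearMap constCoeff constCoeff_one constCoeff_shuffle

theorem gon_coassoc : (TensorProduct.assoc ℚ QX QX QX).toLinearMap ∘ₗ gon.rTensor QX ∘ₗ gon =
    gon.lTensor QX ∘ₗ gon := by
  refine LinearMap.ext fun f => pairing₃_ext fun A B C => ?_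
  have hl : ∀ t, pairing₃ A B C (gon.lTensor QX t) = pairing₂ t A (gl B C) := by
    intro t
    induction t with
    | zero => simp
    | add s t hs ht => simp only [map_add, hs, ht, pairing₂_add, LinearMap.add_apply]
    | tmul f g => simp [pairing₂_gon]
  have hr : ∀ t, pairing₃ A B C (TensorProduct.assoc ℚ QX QX QX (gon.rTensor QX t)) =
      pairing₂ t (gl A B) C := by
    intro t
    induction t with
    | zero => simp
    | add s t hs ht => simp only [map_add, hs, ht, pairing₂_add, LinearMap.add_apply]
    | tmul f g =>
      rw [LinearMap.rTensor_tmul, pairing₂_tmul, ← pairing₂_gon]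
      induction gon f with
      | zero => simp
      | add s t hs ht =>
        simp only [TensorProduct.add_tmul, map_add, hs, ht, pairing₂_add, LinearMap.add_apply,
          add_mul]
      | tmul h k => simp [mul_assoc]
  change pairing₃ A B C (TensorProduct.assoc ℚ QX QX QX (gon.rTensor QX (gon f))) =
    pairing₃ A B C (gon.lTensor QX (gon f))
  rw [hl, hr, pairing₂_gon, pairing₂_gon, gl_assoc]

theorem gon_counit_left : constCoeff.rTensor QX ∘ₗ gon = TensorProduct.mk ℚ ℚ QX 1 := by
  refine LinearMap.ext fun f => (TensorProduct.lid ℚ QX).injective (pairing_ext fun A => ?_)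
  have h : ∀ t, pairing A (TensorProduct.lid ℚ QX (constCoeff.rTensor QX t)) = pairing₂ t 1 A := by
    intro t
    induction t with
    | zero => simp
    | add s t hs ht => simp only [map_add, hs, ht, pairing₂_add, LinearMap.add_apply]
    | tmul f g => simp
  rw [LinearMap.comp_apply, h, pairing₂_gon]
  simp

theorem gon_counit_right : constCoeff.lTensor QX ∘ₗ gon = (TensorProduct.mk ℚ QX ℚ).flip 1 := by
  refine LinearMap.ext fun f => (TensorProduct.rid ℚ QX).injective (pairing_ext fun A => ?_)
  have h : ∀ t, pairing A (TensorProduct.rid ℚ QX (constCoeff.lTensor QX t)) = pairing₂ t A 1 := by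
    intro t
    induction t with
    | zero => simp
    | add s t hs ht => simp only [map_add, hs, ht, pairing₂_add, LinearMap.add_apply]
    | tmul f g => simp [mul_comm]
  rw [LinearMap.comp_apply, h, pairing₂_gon]
  simp

end QX

/-! ### The weight grading -/

namespace QX

theorem word_mem_weightPart (w : Word) : word w ∈ weightPart w.length :=
  Submodule.subset_span ⟨w, rfl, rfl⟩

theorem weightPart_induction {n : ℕ} {P : QX → Prop} (hw : ∀ w : Word, w.length = n → P (word w))
    (h0 : P 0) (hadd : ∀ x y, P x → P y → P (x + y)) (hsmul : ∀ (r : ℚ) x, P x → P (r • x))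
    {x : QX} (hx : x ∈ weightPart n) : P x := by
  induction hx using Submodule.span_induction with
  | mem _ h =>
    obtain ⟨w, hl, rfl⟩ := h
    exact hw w hl
  | zero => exact h0
  | add x y _ _ hx hy => exact hadd x y hx hy
  | smul r x _ hx => exact hsmul r x hx

theorem map_mem_weightPart {F : QX →ₗ[ℚ] QX} {n m : ℕ}
    (h : ∀ w : Word, w.length = n → F (word w) ∈ weightPart m) {x : QX} (hx : x ∈ weightPart n) :
    F x ∈ weightPart m :=
  weightPart_induction (P := fun x => F x ∈ weightPart m) h (by simp)
    (fun x y hx hy => by rw [map_add]; exact add_mem hx hy)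
    (fun r x hx => by rw [map_smul]; exact Submodule.smul_mem _ r hx) hx

theorem cons_mem_weightPart (a : Letter) {n : ℕ} {x : QX} (hx : x ∈ weightPart n) :
    cons a x ∈ weightPart (n + 1) :=
  map_mem_weightPart (fun w hw => by
    rw [cons_word, ← hw]
    exact word_mem_weightPart (a :: w)) hx

theorem shuffleWord_mem_weightPart (u v : Word) :
    shuffleWord u v ∈ weightPart (u.length + v.length) := by
  induction u, v using shuffleWord.induct with
  | case1 v => simpa [shuffleWord] using word_mem_weightPart v
  | case2 a u => simpa [shuffleWord] using word_mem_weightPart (a :: u)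
  | case3 a u b v h₁ h₂ =>
    rw [shuffleWord]
    refine add_mem ?_ ?_
    · convert cons_mem_weightPart a h₁ using 2
      simp only [List.length_cons]
      omega
    · exact cons_mem_weightPart b h₂

theorem mul_mem_weightPart {i j : ℕ} {x y : QX} (hx : x ∈ weightPart i) (hy : y ∈ weightPart j) :
    x * y ∈ weightPart (i + j) := by
  refine map_mem_weightPart (F := shuffle.flip y) (fun u hu => ?_) hx
  refine map_mem_weightPart (F := shuffle (word u)) (fun v hv => ?_) hy
  rw [shuffle_word, ← hu, ← hv]
  exact shuffleWord_mem_weightPart u v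

theorem one_mem_weightPart : (1 : QX) ∈ weightPart 0 := word_mem_weightPart []

theorem iter_mem_weightPart (a b : Letter) (w : Word) :
    iter a (word w) b ∈ weightPart w.length := by
  rw [iter]
  split_ifs
  · rw [constCoeff_word]
    split_ifs with h
    · subst h
      exact Submodule.smul_mem _ _ one_mem_weightPart
    · simp
  · exact word_mem_weightPart w
  · rw [antipode, word, Module.Basis.constr_basis]
    simpa using Submodule.smul_mem _ _ (word_mem_weightPart w.reverse)

/-- The weight `n` part of `ℚ⟨x₀,x₁⟩ ⊗ ℚ⟨x₀,x₁⟩`. -/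
noncomputable def tensorWeightPart (n : ℕ) : Submodule ℚ (QX ⊗[ℚ] QX) :=
  ⨆ (i : ℕ) (j : ℕ) (_ : i + j = n),
    LinearMap.range (TensorProduct.map (weightPart i).subtype (weightPart j).subtype)

theorem tmul_mem_tensorWeightPart {i j : ℕ} {x y : QX} (hx : x ∈ weightPart i)
    (hy : y ∈ weightPart j) : x ⊗ₜ[ℚ] y ∈ tensorWeightPart (i + j) := by
  refine Submodule.mem_iSup_of_mem i (Submodule.mem_iSup_of_mem j
    (Submodule.mem_iSup_of_mem rfl ⟨⟨x, hx⟩ ⊗ₜ[ℚ] ⟨y, hy⟩, by simp⟩))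

theorem tensorWeightPart_le {n : ℕ} {S : Submodule ℚ (QX ⊗[ℚ] QX)}
    (h : ∀ i j x y, i + j = n → x ∈ weightPart i → y ∈ weightPart j → x ⊗ₜ[ℚ] y ∈ S) :
    tensorWeightPart n ≤ S := by
  refine iSup_le fun i => iSup_le fun j => iSup_le fun hij => ?_
  rintro _ ⟨t, rfl⟩
  induction t with
  | zero => simp
  | add s t hs ht => rw [map_add]; exact add_mem hs ht
  | tmul x y => exact h i j x y hij x.2 y.2

theorem step_mem_tensorWeightPart {p : QX} {m n : ℕ} (b : Letter) (hp : p ∈ weightPart m)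
    {t : QX ⊗[ℚ] QX} (ht : t ∈ tensorWeightPart n) :
    step p b t ∈ tensorWeightPart (m + n + 1) := by
  suffices h : tensorWeightPart n ≤ (tensorWeightPart (m + n + 1)).comap (step p b) from h ht
  refine tensorWeightPart_le fun i j x y hij hx hy => ?_
  rw [Submodule.mem_comap, step_tmul, ← hij, ← add_assoc, add_assoc]
  exact tmul_mem_tensorWeightPart (mul_mem_weightPart hp hx) (cons_mem_weightPart b hy)

theorem gonAux_mem_tensorWeightPart (a : Letter) (u w : Word) :
    gonAux a u w ∈ tensorWeightPart (u.length + w.length) := by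
  induction w generalizing a u with
  | nil => exact tmul_mem_tensorWeightPart (iter_mem_weightPart a 0 u) one_mem_weightPart
  | cons b w ih =>
    rw [gonAux]
    refine add_mem ?_ ?_
    · convert ih a (u ++ [b]) using 2
      simp only [List.length_cons, List.length_append, List.length_nil]
      omega
    · convert step_mem_tensorWeightPart b (iter_mem_weightPart a b u) (ih b []) using 2
      simp only [List.length_cons, List.length_nil]
      omega

theorem gon_mem_tensorWeightPart {n : ℕ} {x : QX} (hx : x ∈ weightPart n) :
    gon x ∈ tensorWeightPart n :=
  weightPart_induction (P := fun x => gon x ∈ tensorWeightPart n)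
    (fun w hw => by
      rw [gon_word, ← hw]
      simpa using gonAux_mem_tensorWeightPart 1 [] w)
    (by simp) (fun x y hx hy => by rw [map_add]; exact add_mem hx hy)
    (fun r x hx => by rw [map_smul]; exact Submodule.smul_mem _ r hx) hx

/-- The projection to the weight `n` part. -/
noncomputable def weightProj (n : ℕ) : QX →ₗ[ℚ] QX :=
  basis.constr ℚ fun w => if w.length = n then word w else 0

theorem weightProj_of_mem {m n : ℕ} {x : QX} (hx : x ∈ weightPart m) :
    weightProj n x = if m = n then x else 0 :=
  weightPart_induction (P := fun x => weightProj n x = if m = n then x else 0)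
    (fun w hw => by rw [weightProj, word, Module.Basis.constr_basis, hw]; rfl) (by simp)
    (fun x y hx hy => by rw [map_add, hx, hy]; split_ifs <;> simp)
    (fun r x hx => by rw [map_smul, hx]; split_ifs <;> simp) hx

theorem isInternal_weightPart : DirectSum.IsInternal weightPart := by
  refine (DirectSum.isInternal_submodule_iff_iSupIndep_and_iSup_eq_top _).mpr ⟨fun n => ?_, ?_⟩
  · refine Submodule.disjoint_def.mpr fun x hx hx' => ?_
    have h : ⨆ m, ⨆ (_ : m ≠ n), weightPart m ≤ LinearMap.ker (weightProj n) :=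
      iSup_le fun m => iSup_le fun hm => fun y hy => by
        rw [LinearMap.mem_ker, weightProj_of_mem hy, if_neg hm]
    have h2 := h hx'
    rwa [LinearMap.mem_ker, weightProj_of_mem hx, if_pos rfl] at h2
  · refine Submodule.eq_top_iff'.mpr fun x => ?_
    induction x using induction_word with
    | h w => exact Submodule.mem_iSup_of_mem _ (word_mem_weightPart w)
    | hadd x y hx hy => exact add_mem hx hy
    | hsmul r x hx => exact Submodule.smul_mem _ r hx

theorem finite_weightPart (n : ℕ) : Module.Finite ℚ (weightPart n) :=
  Module.Finite.span_of_finite ℚ ((List.finite_length_eq Letter n).image word)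

/-! ### The antipode -/

open WithConv

/-- The coalgebra `ℚ⟨x₀,x₁⟩` with the Goncharov coproduct. -/
noncomputable instance gonCoalgebra : Coalgebra ℚ QX where
  comul := gon
  counit := constCoeff
  coassoc := gon_coassoc
  rTensor_counit_comp_comul := gon_counit_left
  lTensor_counit_comp_comul := gon_counit_right

theorem conv_apply (f g : WithConv (QX →ₗ[ℚ] QX)) (x : QX) :
    (f * g).ofConv x = LinearMap.mul' ℚ QX (TensorProduct.map f.ofConv g.ofConv (gon x)) := rfl

/-- On weight `n`, a convolution product only involves the values of the factors on weights `i` and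
`j` with `i + j = n`. -/
theorem conv_mem {n : ℕ} {f g : WithConv (QX →ₗ[ℚ] QX)} {S : Submodule ℚ QX}
    (h : ∀ i j x y, i + j = n → x ∈ weightPart i → y ∈ weightPart j →
      f.ofConv x * g.ofConv y ∈ S) {x : QX} (hx : x ∈ weightPart n) : (f * g).ofConv x ∈ S := by
  have hle : tensorWeightPart n ≤
      S.comap (LinearMap.mul' ℚ QX ∘ₗ TensorProduct.map f.ofConv g.ofConv) :=
    tensorWeightPart_le fun i j x y hij hx hy => by simpa using h i j x y hij hx hy
  exact hle (gon_mem_tensorWeightPart hx)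

theorem conv_congr {n : ℕ} {f f' g g' : WithConv (QX →ₗ[ℚ] QX)}
    (hf : ∀ i, i ≤ n → ∀ x ∈ weightPart i, f.ofConv x = f'.ofConv x)
    (hg : ∀ i, i ≤ n → ∀ x ∈ weightPart i, g.ofConv x = g'.ofConv x) {x : QX}
    (hx : x ∈ weightPart n) : (f * g).ofConv x = (f' * g').ofConv x := by
  have hle : tensorWeightPart n ≤
      LinearMap.eqLocus (TensorProduct.map f.ofConv g.ofConv)
        (TensorProduct.map f'.ofConv g'.ofConv) :=
    tensorWeightPart_le fun i j x y hij hx hy => by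
      simp [hf i (by omega) x hx, hg j (by omega) y hy]
  rw [conv_apply, conv_apply, hle (gon_mem_tensorWeightPart hx)]

/-- The element `η ε - id` of the convolution algebra, that is the map `f ↦ (f | 1) 1 - f`. -/
noncomputable def reducedId : WithConv (QX →ₗ[ℚ] QX) := 1 - toConv LinearMap.id

theorem reducedId_apply (x : QX) : reducedId.ofConv x = constCoeff x • (1 : QX) - x := by
  change algebraMap ℚ QX (constCoeff x) - x = _
  rw [Algebra.algebraMap_eq_smul_one]

theorem reducedId_mem {n : ℕ} {x : QX} (hx : x ∈ weightPart n) :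
    reducedId.ofConv x ∈ weightPart n :=
  map_mem_weightPart (fun w hw => by
    rw [reducedId_apply, constCoeff_word, ← hw]
    split_ifs with h
    · subst h
      exact sub_mem (Submodule.smul_mem _ _ one_mem_weightPart) (word_mem_weightPart _)
    · rw [zero_smul, zero_sub]
      exact neg_mem (word_mem_weightPart w)) hx

theorem reducedId_eq_zero {x : QX} (hx : x ∈ weightPart 0) : reducedId.ofConv x = 0 :=
  weightPart_induction (P := fun x => reducedId.ofConv x = 0)
    (fun w hw => by
      rw [List.length_eq_zero_iff.mp hw, ← one_def, reducedId_apply]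
      simp)
    (by simp) (fun x y hx hy => by rw [map_add, hx, hy, add_zero])
    (fun r x hx => by rw [map_smul, hx, smul_zero]) hx

theorem reducedId_pow_mem (k : ℕ) {n : ℕ} {x : QX} (hx : x ∈ weightPart n) :
    (reducedId ^ k).ofConv x ∈ weightPart n := by
  induction k generalizing n x with
  | zero =>
    have h : (reducedId ^ 0).ofConv x = reducedId.ofConv x + x := by
      rw [pow_zero, reducedId_apply, sub_add_cancel]
      change algebraMap ℚ QX (constCoeff x) = _
      rw [Algebra.algebraMap_eq_smul_one]
    rw [h]
    exact add_mem (reducedId_mem hx) hx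
  | succ k ih =>
    rw [pow_succ']
    refine conv_mem (fun i j x y hij hx hy => ?_) hx
    rw [← hij]
    exact mul_mem_weightPart (reducedId_mem hx) (ih hy)

/-- The convolution algebra element `η ε - id` is locally nilpotent: it kills weight `0`, so each
factor of a nonzero term uses up at least one letter. -/
theorem reducedId_pow_eq_zero {k n : ℕ} (h : n < k) {x : QX} (hx : x ∈ weightPart n) :
    (reducedId ^ k).ofConv x = 0 := by
  induction k generalizing n x with
  | zero => omega
  | succ k ih =>
    rw [pow_succ', ← Submodule.mem_bot ℚ]
    refine conv_mem (fun i j x y hij hx hy => ?_) hx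
    rw [Submodule.mem_bot]
    rcases Nat.eq_zero_or_pos i with rfl | hi
    · rw [reducedId_eq_zero hx, zero_mul]
    · rw [ih (by omega) hy, mul_zero]

/-- The partial sums of the geometric series for the convolution inverse of the identity. -/
noncomputable def geomSum (N : ℕ) : WithConv (QX →ₗ[ℚ] QX) :=
  ∑ k ∈ Finset.range (N + 1), reducedId ^ k

theorem geomSum_apply (N : ℕ) (x : QX) :
    (geomSum N).ofConv x = ∑ k ∈ Finset.range (N + 1), (reducedId ^ k).ofConv x := by
  simp [geomSum]

/-- The antipode for the Goncharov coproduct, the convolution inverse `∑ (η ε - id)ᵏ` of the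
identity; on words with `n` letters the terms with `k > n` vanish. -/
noncomputable def gonAntipode : QX →ₗ[ℚ] QX :=
  basis.constr ℚ fun w => (geomSum w.length).ofConv (word w)

theorem geomSum_eq {n N : ℕ} (h : n ≤ N) {x : QX} (hx : x ∈ weightPart n) :
    (geomSum N).ofConv x = (geomSum n).ofConv x := by
  rw [geomSum_apply, geomSum_apply]
  refine (Finset.sum_subset (Finset.range_mono (by omega)) fun k _ hk => ?_).symm
  exact reducedId_pow_eq_zero (by simpa using hk) hx

theorem gonAntipode_eq {n N : ℕ} (h : n ≤ N) {x : QX} (hx : x ∈ weightPart n) :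
    gonAntipode x = (geomSum N).ofConv x := by
  rw [geomSum_eq h hx]
  exact weightPart_induction (P := fun x => gonAntipode x = (geomSum n).ofConv x)
    (fun w hw => by rw [gonAntipode, word, Module.Basis.constr_basis, hw]; rfl) (by simp)
    (fun x y hx hy => by rw [map_add, map_add, hx, hy])
    (fun r x hx => by rw [map_smul, map_smul, hx]) hx

theorem gonAntipode_mem {n : ℕ} {x : QX} (hx : x ∈ weightPart n) :
    gonAntipode x ∈ weightPart n := by
  rw [gonAntipode_eq le_rfl hx, geomSum_apply]
  exact sum_mem fun k _ => reducedId_pow_mem k hx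

theorem toConv_id : toConv (LinearMap.id : QX →ₗ[ℚ] QX) = 1 - reducedId := by
  rw [reducedId, sub_sub_cancel]

theorem one_sub_pow_apply {n : ℕ} {x : QX} (hx : x ∈ weightPart n) :
    (1 - reducedId ^ (n + 1)).ofConv x = (1 : WithConv (QX →ₗ[ℚ] QX)).ofConv x := by
  rw [ofConv_sub, LinearMap.sub_apply, reducedId_pow_eq_zero (Nat.lt_succ_self n) hx, sub_zero]

theorem gonAntipode_mul_id : toConv gonAntipode * toConv LinearMap.id = 1 := by
  refine ofConv_injective (linearMap_ext fun w => ?_)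
  have hw := word_mem_weightPart w
  rw [← one_sub_pow_apply hw, ← geom_sum_mul_neg, ← toConv_id]
  exact conv_congr (fun i hi x hx => gonAntipode_eq hi hx) (fun _ _ _ _ => rfl) hw

theorem id_mul_gonAntipode : toConv LinearMap.id * toConv gonAntipode = 1 := by
  refine ofConv_injective (linearMap_ext fun w => ?_)
  have hw := word_mem_weightPart w
  rw [← one_sub_pow_apply hw, ← mul_neg_geom_sum, ← toConv_id]
  exact conv_congr (fun _ _ _ _ => rfl) (fun i hi x hx => gonAntipode_eq hi hx) hw

theorem isHopfAlgebra_gon : IsHopfAlgebra gonHom counitHom gonAntipode where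
  coassoc := gon_coassoc
  counit_left := gon_counit_left
  counit_right := gon_counit_right
  antipode_left := toConv_injective gonAntipode_mul_id
  antipode_right := toConv_injective id_mul_gonAntipode

theorem isHopfGrading_gon : IsHopfGrading weightPart gon gonAntipode where
  isInternal := isInternal_weightPart
  free _ := inferInstance
  finite := finite_weightPart
  one_mem := one_mem_weightPart
  mul_mem _ _ _ hx _ hy := mul_mem_weightPart hx hy
  comul_mem _ _ hx := gon_mem_tensorWeightPart hx
  antipode_mem _ _ hx := gonAntipode_mem hx

end QX

/-! ### Series and their truncations -/

namespace Series

theorem pair_word (φ : Series) (w : Word) : pair φ (QX.word w) = φ w :=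
  QX.basis.constr_basis ℚ φ w

/-- Only the summand of the word `w` itself contributes. -/
theorem pairing_trunc {N : ℕ} (φ : Series) {w : Word} (h : w.length ≤ N) :
    UL.pairing (trunc N φ) (QX.word w) = φ w := by
  simp only [trunc, map_sum, map_smul, LinearMap.sum_apply, LinearMap.smul_apply, UL.pairing_word]
  rw [Finset.sum_eq_single w.length, Finset.sum_eq_single w.get]
  · simp
  · intro u _ hu
    rw [if_neg, smul_zero]
    exact fun h' => hu (List.ofFn_injective (h'.trans (List.ofFn_get w).symm))
  · simp
  · intro n _ hn
    refine Finset.sum_eq_zero fun u _ => ?_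
    rw [if_neg, smul_zero]
    rintro rfl
    simp at hn
  · intro hw
    simp at hw
    omega

theorem pairing_trunc_of_mem {n N : ℕ} (φ : Series) (h : n ≤ N) {x : QX}
    (hx : x ∈ QX.weightPart n) : UL.pairing (trunc N φ) x = pair φ x :=
  QX.weightPart_induction (P := fun x => UL.pairing (trunc N φ) x = pair φ x)
    (fun w hw => by rw [pairing_trunc φ (hw.trans_le h), pair_word]) (by simp)
    (fun x y hx hy => by rw [map_add, map_add, hx, hy])
    (fun r x hx => by rw [map_smul, map_smul, hx]) hx

theorem pairTensor_of_mem {N : ℕ} (φ ψ : Series) {t : QX ⊗[ℚ] QX}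
    (ht : t ∈ QX.tensorWeightPart N) :
    pairTensor φ ψ t = UL.pairing₂ t (trunc N φ) (trunc N ψ) := by
  have hle : QX.tensorWeightPart N ≤ LinearMap.eqLocus (pairTensor φ ψ)
      (LinearMap.mul' ℚ ℚ ∘ₗ
        TensorProduct.map (UL.pairing (trunc N φ)) (UL.pairing (trunc N ψ))) :=
    QX.tensorWeightPart_le fun i j x y hij hx hy => by
      simp [pairTensor, pairing_trunc_of_mem φ (show i ≤ N by omega) hx,
        pairing_trunc_of_mem ψ (show j ≤ N by omega) hy]
  exact hle ht

/-- The truncations at the weight of a word reduce the formula for series to the duality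
`UL.pairing₂_gon`, which is bilinear and so holds without multiplicativity of `φ`. -/
theorem pair_grossmanLarson (φ ψ : Series) (x : QX) :
    pair (grossmanLarson φ ψ) x = pairTensor φ ψ (QX.gon x) := by
  have : pair (grossmanLarson φ ψ) = pairTensor φ ψ ∘ₗ QX.gon := QX.linearMap_ext fun w => by
    rw [LinearMap.comp_apply, pair_word, grossmanLarson, UL.coeff_eq_pairing,
      UL.grossmanLarson_eq_gl, ← UL.pairing₂_gon,
      pairTensor_of_mem φ ψ (QX.gon_mem_tensorWeightPart (QX.word_mem_weightPart w))]
  rw [this]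
  rfl

end Series

end Goncharov

theorem mainTheorem10 :
    (∀ G H : Goncharov.Series, Goncharov.Series.IsGrouplike G → ∀ w : Goncharov.QX,
      Goncharov.Series.pair (Goncharov.Series.grossmanLarson G H) w =
        Goncharov.Series.pairTensor G H (Goncharov.QX.gon w)) ∧
    ∃ (Δ : Goncharov.QX →ₐ[ℚ] Goncharov.QX ⊗[ℚ] Goncharov.QX)
      (ε : Goncharov.QX →ₐ[ℚ] ℚ) (S : Goncharov.QX →ₗ[ℚ] Goncharov.QX),
      Δ.toLinearMap = Goncharov.QX.gon ∧
      Goncharov.IsHopfAlgebra Δ ε S ∧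
      Goncharov.IsHopfGrading Goncharov.QX.weightPart Goncharov.QX.gon S :=
  ⟨fun G H _ => Goncharov.Series.pair_grossmanLarson G H, Goncharov.QX.gonHom,
    Goncharov.QX.counitHom, Goncharov.QX.gonAntipode, rfl, Goncharov.QX.isHopfAlgebra_gon,
    Goncharov.QX.isHopfGrading_gon⟩
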